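/- Let $\alpha$ be a real quadratic number, that is, a real number of degree $2$ over $\mathbb{Q}$. Write $x^{\sigma}$ for the Galois conjugate of a real quadratic number $x$, let $PSL(2,\mathbb{Z})$ act on real irrational numbers by fractional linear transformations, and let $\Theta_\alpha = PSL(2,\mathbb{Z})\{\alpha,\alpha^{\sigma}\}$ be the union of the orbits of $\alpha$ and $\alpha^{\sigma}$. The quadratic Lagrange spectrum $Sp_\alpha$ of $\alpha$ is the set of the real values $$c_\alpha(\xi) = \liminf_{\beta\in\Theta_\alpha,\ |\beta-\beta^{\sigma}|\to 0} 2\,\frac{|\xi-\beta|}{|\beta-\beta^{\sigma}|},$$ where $\xi$ runs over all real numbers not in $\mathbb{Q}\cup\Theta_\alpha$. Let $b_1,\dots,b_s$ be the shortest period of the (eventually periodic) continued fraction expansion of $\alpha$, so that $s$ is its length, and put $B = 2+\max(b_1,\dots,b_s)$. Let $n$ be the minimal positive integer with $$2^{(n-1)s} > 16\cdot 16\cdot 36\cdot 144\, B^{2s+8},$$ and put $$\psi(\alpha) = \frac{1}{72\cdot 72\, B^{s(6n+6)+4}}.$$ Then $\psi(\alpha)>0$ and $[0,\psi(\alpha)]\subset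 Sp_\alpha$. -/

import Mathlib

open Filter Topology

noncomputable section

namespace QuadLagrange

/-- A real quadratic number: a real number of degree two over `ℚ`. -/
def IsRealQuadratic (x : ℝ) : Prop := (minpoly ℚ x).natDegree = 2

/-- The Galois conjugate `x^σ` of a real quadratic number `x`: the other root of its minimal
polynomial `X ^ 2 + b X + c`, namely `-b - x` (see `galConj_spec`). -/
def galConj (x : ℝ) : ℝ := -((minpoly ℚ x).coeff 1 : ℝ) - x

theorem galConj_spec {x : ℝ} (hx : IsRealQuadratic x) :
    galConj x ≠ x ∧ IsConjRoot ℚ x (galConj x) := by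
  have h2 : (minpoly ℚ x).natDegree = 2 := hx
  have hint : IsIntegral ℚ x := by
    by_contra h
    rw [minpoly.eq_zero h] at h2
    simp at h2
  have hmon := minpoly.monic hint
  have hc2 : (minpoly ℚ x).coeff 2 = 1 := by
    have := hmon.coeff_natDegree
    rwa [h2] at this
  have hae : ∀ y : ℝ, Polynomial.aeval y (minpoly ℚ x) =
      ((minpoly ℚ x).coeff 0 : ℝ) + ((minpoly ℚ x).coeff 1 : ℝ) * y + y ^ 2 := by
    intro y
    rw [Polynomial.aeval_eq_sum_range, h2]
    simp [Finset.sum_range_succ, Algebra.smul_def, hc2]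
  have hx0 := minpoly.aeval ℚ x
  rw [hae] at hx0
  refine ⟨fun h => ?_, ?_⟩
  · have hrat : x = algebraMap ℚ ℝ (-((minpoly ℚ x).coeff 1) / 2) := by
      unfold galConj at h
      simp only [eq_ratCast]
      push_cast
      linarith
    have := minpoly.eq_X_sub_C ℝ (-((minpoly ℚ x).coeff 1) / 2 : ℚ)
    rw [← hrat] at this
    rw [this, Polynomial.natDegree_X_sub_C] at h2
    omega
  · refine minpoly.eq_of_irreducible_of_monic (minpoly.irreducible hint) ?_ hmon
    rw [hae]
    unfold galConj
    linear_combination hx0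

/-- The action of an integral matrix of determinant one (hence of its class in `PSL(2, ℤ)`) by
the fractional linear transformation `x ↦ (a x + b) / (c x + d)`. It is only applied to irrational
numbers, where the denominator does not vanish. -/
def moebius (g : Matrix.SpecialLinearGroup (Fin 2) ℤ) (x : ℝ) : ℝ :=
  ((g.1 0 0 : ℝ) * x + (g.1 0 1 : ℝ)) / ((g.1 1 0 : ℝ) * x + (g.1 1 1 : ℝ))

/-- `Θ_α`, the union of the `PSL(2, ℤ)`-orbits of `α` and `α^σ`. -/
def Theta (α : ℝ) : Set ℝ :=
  {β | ∃ g : Matrix.SpecialLinearGroup (Fin 2) ℤ, β = moebius g α ∨ β = moebius g (galConj α)}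

/-- `c_α(ξ) = liminf 2 |ξ - β| / |β - β^σ|` over `β ∈ Θ_α` with `|β - β^σ| → 0`, taken in the
extended reals so that an infinite lower limit is not replaced by a real default value. -/
def approxConst (α ξ : ℝ) : EReal :=
  liminf (fun β : ℝ => ((2 * |ξ - β| / |β - galConj β| : ℝ) : EReal))
    (comap (fun β : ℝ => |β - galConj β|) (𝓝 0) ⊓ 𝓟 (Theta α))

/-- The quadratic Lagrange spectrum `Sp_α`. -/
def Sp (α : ℝ) : Set ℝ :=
  {c | ∃ ξ : ℝ, Irrational ξ ∧ ξ ∉ Theta α ∧ approxConst α ξ = (c : EReal)}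

/-- The `k`-th complete quotient in the continued fraction expansion of `x`: it starts with `x`,
and `t` is followed by `1 / (t - ⌊t⌋)`. -/
def completeQuot (x : ℝ) (k : ℕ) : ℝ := (fun t : ℝ => (Int.fract t)⁻¹)^[k] x

/-- The `k`-th partial quotient `a_k` of `x = [a_0, a_1, a_2, …]`. -/
def partialQuot (x : ℝ) (k : ℕ) : ℤ := ⌊completeQuot x k⌋

/-- The partial quotients of `x` are periodic with period `s` from index `N` on. -/
def PeriodicFrom (x : ℝ) (N s : ℕ) : Prop :=
  ∀ k, N ≤ k → partialQuot x (k + s) = partialQuot x k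

/-- The length `s` of the shortest period of the continued fraction expansion of `x`. -/
def periodLength (x : ℝ) : ℕ := sInf {s | 0 < s ∧ ∃ N, PeriodicFrom x N s}

/-- The length of the preperiod of the continued fraction expansion of `x`. -/
def preperiodLength (x : ℝ) : ℕ := sInf {N | PeriodicFrom x N (periodLength x)}

/-- `B = 2 + max (b_1, …, b_s)`, where `b_1, …, b_s` is the period of `x`. -/
def periodBound (x : ℝ) : ℕ :=
  2 + (Finset.range (periodLength x)).sup
    (fun i => (partialQuot x (preperiodLength x + i)).toNat)

/-- The minimal positive integer `n` such that
`2 ^ ((n - 1) s) > 16 * 16 * 36 * 144 * B ^ (2 s + 8)`. -/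
def minExp (s B : ℕ) : ℕ :=
  sInf {n | 0 < n ∧ 16 * 16 * 36 * 144 * B ^ (2 * s + 8) < 2 ^ ((n - 1) * s)}

/-- `ψ(α) = 1 / (72 * 72 * B ^ (s (6 n + 6) + 4))`. -/
def psi (α : ℝ) : ℝ :=
  1 / (72 * 72 * (periodBound α : ℝ) ^
    (periodLength α * (6 * minExp (periodLength α) (periodBound α) + 6) + 4))

end QuadLagrange

end

/-! All elements of `Theta α` are roots of integral forms of one discriminant `w ^ 2`. Distinct ones
repel each other: `|β - γ| * |σ β - σ γ|` is at least `1 / (2 w ^ 2)` times the product of the gaps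
`|β - σ β|` and `|γ - σ γ|` (`ConjPair.separation`). This rigidity puts every `c` with `0 ≤ c ≤ 10⁻⁷
w⁻⁵` in the spectrum.

The ratio `2 |t - β| / |β - σ β|` is twice a cross ratio of `∞, t, β, σ β`. Let `γ` be an orbit
element of largest gap. A nested interval argument on a one-parameter family of pairs `(x, y)`
realises the value `c` for `x, y, γ, σ γ`, with `x` and `y` badly approximable by the rest of the
orbit (`exists_pair_badly_approximable`). Replacing `x, y` by nearby rationals and moving `y` to
infinity gives a rational `t` whose best constant over the whole orbit is almost `c`
(`exists_rat_approx_const`).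

Translating `t` by a large integer and moving infinity to a rational `r₀` yields such rationals
arbitrarily close to `r₀`, if gaps above a threshold are ignored; the threshold does not depend on
the closeness (`exists_rat_near`). Iterating, one gets a rapidly convergent sequence of rationals,
each of which controls one range of gaps; its limit has constant exactly `c`
(`exists_real_approx_const`).

Finally, a complete quotient inside the period is fixed by a product of `s` nonnegative matrices, so
`w ^ 2 ≤ B ^ (2 s + 2)` (`exists_conjPair_le`), and `psi α` lies below `10⁻⁷ w⁻⁵` with room to spare
(`psi_mul_le`). -/

noncomputable section

namespace QuadLagrange

/-! ### Integral forms of fixed discriminant and repulsion of their roots -/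

/-- `x` and `y` are the two roots of an integral binary quadratic form whose discriminant is
`w ^ 2`. -/
def ConjPair (w x y : ℝ) : Prop :=
  ∃ a b c : ℤ, (a : ℝ) * (x - y) = w ∧ (a : ℝ) * (x + y) = b ∧ (a : ℝ) * (x * y) = c

namespace ConjPair

variable {w x y x₁ y₁ x₂ y₂ : ℝ}

theorem symm (h : ConjPair w x y) : ConjPair w y x := by
  obtain ⟨a, b, c, h1, h2, h3⟩ := h
  refine ⟨-a, -b, -c, ?_, ?_, ?_⟩ <;> push_cast <;> linarith

theorem one_le_abs_intCast {m : ℤ} (hm : (m : ℝ) ≠ 0) : 1 ≤ |(m : ℝ)| := by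
  have : m ≠ 0 := by exact_mod_cast hm
  exact_mod_cast Int.one_le_abs this

/-- Distinct roots of integral forms of the same discriminant repel each other. -/
theorem separation (hw : 0 < w) (h₁ : ConjPair w x₁ y₁) (h₂ : ConjPair w x₂ y₂)
    (hx : x₁ ≠ x₂) (hy : y₁ ≠ y₂) :
    |x₁ - y₁| * |x₂ - y₂| ≤ 2 * w ^ 2 * (|x₁ - x₂| * |y₁ - y₂|) := by
  obtain ⟨a, b, c, h1, h2, h3⟩ := h₁
  obtain ⟨a', b', c', h1', h2', h3'⟩ := h₂
  have ha : (a : ℝ) ≠ 0 := by rintro h; rw [h] at h1; linarith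
  have ha' : (a' : ℝ) ≠ 0 := by rintro h; rw [h] at h1'; linarith
  -- The polarised discriminant is an integer. Adding `w ^ 2`, which is both `b ^ 2 - 4 a c` and `a
  -- a' (x₁ - y₁) (x₂ - y₂)`, makes it split into differences of roots.
  have key : ((2 * a' * c + 2 * a * c' - b * b' + (b ^ 2 - 4 * a * c) : ℤ) : ℝ) =
      2 * a * a' * ((x₁ - x₂) * (y₁ - y₂)) := by
    push_cast
    have e1 : (b : ℝ) ^ 2 - 4 * a * c = (a * (x₁ - y₁)) * (a' * (x₂ - y₂)) := by
      rw [h1, h1', ← h2, ← h3, ← h1]; ring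
    rw [e1, ← h2, ← h3, ← h2', ← h3']; ring
  have hne : ((2 * a' * c + 2 * a * c' - b * b' + (b ^ 2 - 4 * a * c) : ℤ) : ℝ) ≠ 0 := by
    rw [key]
    have := sub_ne_zero.2 hx
    have := sub_ne_zero.2 hy
    positivity
  have h := one_le_abs_intCast hne
  rw [key] at h
  simp only [abs_mul, abs_two] at h
  have e : |(a : ℝ)| * |x₁ - y₁| = w := by rw [← abs_mul, h1, abs_of_pos hw]
  have e' : |(a' : ℝ)| * |x₂ - y₂| = w := by rw [← abs_mul, h1', abs_of_pos hw]
  calc |x₁ - y₁| * |x₂ - y₂|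
      ≤ |x₁ - y₁| * |x₂ - y₂| * (2 * |(a : ℝ)| * |(a' : ℝ)| * (|x₁ - x₂| * |y₁ - y₂|)) :=
        le_mul_of_one_le_right (by positivity) h
    _ = 2 * (|(a : ℝ)| * |x₁ - y₁|) * (|(a' : ℝ)| * |x₂ - y₂|) * (|x₁ - x₂| * |y₁ - y₂|) := by ring
    _ = _ := by rw [e, e']; ring

/-- Rational numbers are badly approximable by roots of integral forms. -/
theorem le_of_rat (hw : 0 < w) (h : ConjPair w x y) (z : ℚ) (hx : (z : ℝ) ≠ x)
    (hy : (z : ℝ) ≠ y) :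
    |x - y| ≤ w * z.den ^ 2 * (|z - x| * |z - y|) := by
  obtain ⟨a, b, c, h1, h2, h3⟩ := h
  have ha : (a : ℝ) ≠ 0 := by rintro h; rw [h] at h1; linarith
  have hq : (z.den : ℝ) ≠ 0 := by exact_mod_cast z.den_ne_zero
  have hz : (z : ℝ) * z.den = z.num := by exact_mod_cast Rat.mul_den_eq_num z
  have key : ((a * z.num ^ 2 - b * z.num * z.den + c * z.den ^ 2 : ℤ) : ℝ) =
      a * z.den ^ 2 * ((z - x) * (z - y)) := by
    push_cast
    rw [← h2, ← h3, ← hz]; ring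
  have hne : ((a * z.num ^ 2 - b * z.num * z.den + c * z.den ^ 2 : ℤ) : ℝ) ≠ 0 := by
    rw [key]
    have := sub_ne_zero.2 hx
    have := sub_ne_zero.2 hy
    positivity
  have h := one_le_abs_intCast hne
  rw [key] at h
  simp only [abs_mul, abs_pow, Nat.abs_cast] at h
  have e : |(a : ℝ)| * |x - y| = w := by rw [← abs_mul, h1, abs_of_pos hw]
  calc |x - y| ≤ |x - y| * (|(a : ℝ)| * z.den ^ 2 * (|z - x| * |z - y|)) :=
        le_mul_of_one_le_right (by positivity) h
    _ = (|(a : ℝ)| * |x - y|) * z.den ^ 2 * (|z - x| * |z - y|) := by ring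
    _ = _ := by rw [e]

end ConjPair

/-! ### The modular action on irrationals and on conjugate pairs -/

theorem denom_ne_zero (g : Matrix.SpecialLinearGroup (Fin 2) ℤ) {x : ℝ} (hx : Irrational x) :
    (g.1 1 0 : ℝ) * x + g.1 1 1 ≠ 0 := by
  intro h
  have hdet := g.2
  rw [Matrix.det_fin_two] at hdet
  by_cases hc : g.1 1 0 = 0
  · rw [hc] at h hdet
    have : g.1 1 1 = 0 := by simpa using h
    rw [this] at hdet
    simp at hdet
  · have hc' : (g.1 1 0 : ℝ) ≠ 0 := by exact_mod_cast hc
    refine hx ⟨-(g.1 1 1) / (g.1 1 0), ?_⟩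
    push_cast
    field_simp
    linarith

theorem det_cast (g : Matrix.SpecialLinearGroup (Fin 2) ℤ) :
    (g.1 0 0 : ℝ) * g.1 1 1 - (g.1 0 1 : ℝ) * g.1 1 0 = 1 := by
  have hdet := g.2
  rw [Matrix.det_fin_two] at hdet
  exact_mod_cast hdet

theorem moebius_sub (g : Matrix.SpecialLinearGroup (Fin 2) ℤ) {x y : ℝ}
    (hx : (g.1 1 0 : ℝ) * x + g.1 1 1 ≠ 0) (hy : (g.1 1 0 : ℝ) * y + g.1 1 1 ≠ 0) :
    moebius g x - moebius g y =
      (x - y) / (((g.1 1 0 : ℝ) * x + g.1 1 1) * ((g.1 1 0 : ℝ) * y + g.1 1 1)) := by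
  unfold moebius
  rw [div_sub_div _ _ hx hy]
  congr 1
  linear_combination (x - y) * det_cast g

theorem moebius_mul (g h : Matrix.SpecialLinearGroup (Fin 2) ℤ) {x : ℝ} (hx : Irrational x) :
    moebius (g * h) x = moebius g (moebius h x) := by
  have h1 := denom_ne_zero h hx
  have h2 := denom_ne_zero (g * h) hx
  have e : ∀ i j, (g * h).1 i j = g.1 i 0 * h.1 0 j + g.1 i 1 * h.1 1 j := by
    intro i j
    simp [Matrix.mul_apply, Fin.sum_univ_two]
  rw [e, e] at h2
  push_cast at h2
  unfold moebius
  simp only [e]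
  push_cast
  have h3 : (g.1 1 0 : ℝ) * (((h.1 0 0 : ℝ) * x + h.1 0 1) / ((h.1 1 0 : ℝ) * x + h.1 1 1))
      + g.1 1 1 = ((g.1 1 0 * h.1 0 0 + g.1 1 1 * h.1 1 0 : ℝ) * x +
        (g.1 1 0 * h.1 0 1 + g.1 1 1 * h.1 1 1)) / ((h.1 1 0 : ℝ) * x + h.1 1 1) := by
    rw [mul_div_assoc', div_add' _ _ _ h1]
    ring
  have h4 : (g.1 0 0 : ℝ) * (((h.1 0 0 : ℝ) * x + h.1 0 1) / ((h.1 1 0 : ℝ) * x + h.1 1 1))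
      + g.1 0 1 = ((g.1 0 0 * h.1 0 0 + g.1 0 1 * h.1 1 0 : ℝ) * x +
        (g.1 0 0 * h.1 0 1 + g.1 0 1 * h.1 1 1)) / ((h.1 1 0 : ℝ) * x + h.1 1 1) := by
    rw [mul_div_assoc', div_add' _ _ _ h1]
    ring
  rw [h3, h4, div_div_div_cancel_right₀ h1]

theorem moebius_one (x : ℝ) : moebius 1 x = x := by
  simp [moebius]

theorem moebius_inv_moebius (g : Matrix.SpecialLinearGroup (Fin 2) ℤ) {x : ℝ}
    (hx : Irrational x) : moebius g⁻¹ (moebius g x) = x := by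
  rw [← moebius_mul _ _ hx, inv_mul_cancel, moebius_one]

theorem irrational_moebius (g : Matrix.SpecialLinearGroup (Fin 2) ℤ) {x : ℝ}
    (hx : Irrational x) : Irrational (moebius g x) := by
  rintro ⟨q, hq⟩
  apply hx
  have h1 := denom_ne_zero g hx
  have h2 : (q : ℝ) * ((g.1 1 0 : ℝ) * x + g.1 1 1) = (g.1 0 0 : ℝ) * x + g.1 0 1 := by
    rw [hq, moebius, div_mul_cancel₀ _ h1]
  have hd := det_cast g
  have h3 : (g.1 0 0 : ℝ) - q * g.1 1 0 ≠ 0 := by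
    intro h
    have h4 : (q : ℝ) * g.1 1 1 = g.1 0 1 := by linear_combination h2 + x * h
    have : ((g.1 0 0 : ℝ) - q * g.1 1 0) * g.1 1 1 = 1 := by
      linear_combination hd - g.1 1 0 * h4
    rw [h, zero_mul] at this
    exact zero_ne_one this
  refine ⟨(q * g.1 1 1 - g.1 0 1) / (g.1 0 0 - q * g.1 1 0), ?_⟩
  push_cast
  rw [div_eq_iff h3]
  linear_combination h2

theorem ConjPair.moebius {w x y : ℝ} (g : Matrix.SpecialLinearGroup (Fin 2) ℤ)
    (hx : Irrational x) (hy : Irrational y) (h : ConjPair w x y) :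
    ConjPair w (moebius g x) (moebius g y) := by
  obtain ⟨a, b, c, h1, h2, h3⟩ := h
  have hx' := denom_ne_zero g hx
  have hy' := denom_ne_zero g hy
  have key : ((c * g.1 1 0 ^ 2 + b * g.1 1 0 * g.1 1 1 + a * g.1 1 1 ^ 2 : ℤ) : ℝ) =
      a * (((g.1 1 0 : ℝ) * x + g.1 1 1) * ((g.1 1 0 : ℝ) * y + g.1 1 1)) := by
    push_cast; rw [← h2, ← h3]; ring
  refine ⟨c * g.1 1 0 ^ 2 + b * g.1 1 0 * g.1 1 1 + a * g.1 1 1 ^ 2,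
    2 * c * g.1 0 0 * g.1 1 0 + b * (g.1 0 0 * g.1 1 1 + g.1 0 1 * g.1 1 0) +
      2 * a * g.1 0 1 * g.1 1 1,
    c * g.1 0 0 ^ 2 + b * g.1 0 0 * g.1 0 1 + a * g.1 0 1 ^ 2, ?_, ?_, ?_⟩
  · rw [key, moebius_sub g hx' hy', ← h1]
    field_simp
  · rw [key]
    push_cast
    rw [← h2, ← h3, QuadLagrange.moebius, QuadLagrange.moebius, div_add_div _ _ hx' hy', mul_assoc,
      mul_div_cancel₀ _ (mul_ne_zero hx' hy')]
    ring
  · rw [key]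
    push_cast
    rw [← h2, ← h3, QuadLagrange.moebius, QuadLagrange.moebius, div_mul_div_comm, mul_assoc,
      mul_div_cancel₀ _ (mul_ne_zero hx' hy')]
    ring

/-! ### Orbits and points badly approximable by them -/

/-- A set of quadratic irrationals with a conjugation, stable under the modular group, all of
whose elements are roots of integral forms of discriminant `w ^ 2`. -/
structure OrbitSystem (w : ℝ) (S : Set ℝ) (σ : ℝ → ℝ) : Prop where
  one_le : 1 ≤ w
  nonempty : S.Nonempty
  irr : ∀ β ∈ S, Irrational β
  conj_mem : ∀ β ∈ S, σ β ∈ S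
  conj_conj : ∀ β ∈ S, σ (σ β) = β
  pair : ∀ β ∈ S, ConjPair w β (σ β)
  moebius_mem : ∀ g, ∀ β ∈ S, moebius g β ∈ S
  conj_moebius : ∀ g, ∀ β ∈ S, σ (moebius g β) = moebius g (σ β)

/-- Nested intervals of length `4⁻ʲ`. An interval of length `l` has three subintervals of length `l
/ 4` separated by `l / 8`. If each contained a bad point, two of these points would belong to the
same one of `A j`, `B j` at distance at least `l / 8`, against sparseness. -/
theorem exists_forall_not_mem_of_sparse (A B : ℕ → Set ℝ)
    (hA : ∀ j, ∀ s ∈ A j, ∀ t ∈ A j, s ∈ Set.Icc (1 : ℝ) 2 → t ∈ Set.Icc (1 : ℝ) 2 →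
      |s - t| ≤ (1 / 4 : ℝ) ^ j → |s - t| < (1 / 4 : ℝ) ^ j / 8)
    (hB : ∀ j, ∀ s ∈ B j, ∀ t ∈ B j, s ∈ Set.Icc (1 : ℝ) 2 → t ∈ Set.Icc (1 : ℝ) 2 →
      |s - t| ≤ (1 / 4 : ℝ) ^ j → |s - t| < (1 / 4 : ℝ) ^ j / 8) :
    ∃ η ∈ Set.Icc (1 : ℝ) 2, ∀ j, η ∉ A j ∧ η ∉ B j := by
  have step : ∀ j : ℕ, ∀ p : ℝ, 1 ≤ p → p + (1 / 4 : ℝ) ^ j ≤ 2 → ∃ p' : ℝ, p ≤ p' ∧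
      p' + (1 / 4 : ℝ) ^ (j + 1) ≤ p + (1 / 4 : ℝ) ^ j ∧
      ∀ t ∈ Set.Icc p' (p' + (1 / 4 : ℝ) ^ (j + 1)), t ∉ A j ∧ t ∉ B j := by
    intro j p hp hp2
    have hl : (0 : ℝ) < (1 / 4 : ℝ) ^ j := by positivity
    rw [pow_succ]
    set l := (1 / 4 : ℝ) ^ j
    have sep : ∀ C : Set ℝ, (∀ s ∈ C, ∀ t ∈ C, s ∈ Set.Icc (1 : ℝ) 2 → t ∈ Set.Icc (1 : ℝ) 2 →
        |s - t| ≤ l → |s - t| < l / 8) → ∀ s ∈ C, ∀ t ∈ C, p ≤ s → s + l / 8 ≤ t → t ≤ p + l →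
        False := by
      intro C hC s hs t ht h1 h2 h3
      have := hC s hs t ht ⟨by linarith, by linarith⟩ ⟨by linarith, by linarith⟩
        (by rw [abs_le]; constructor <;> linarith)
      rw [abs_lt] at this
      linarith
    by_contra hcon
    push Not at hcon
    obtain ⟨t1, ⟨h1, h1'⟩, b1⟩ := hcon p le_rfl (by linarith)
    obtain ⟨t2, ⟨h2, h2'⟩, b2⟩ := hcon (p + 3 / 8 * l) (by linarith) (by linarith)
    obtain ⟨t3, ⟨h3, h3'⟩, b3⟩ := hcon (p + 3 / 4 * l) (by linarith) (by linarith)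
    have a12 := fun u v => sep (A j) (hA j) t1 u t2 v h1 (by linarith) (by linarith)
    have a13 := fun u v => sep (A j) (hA j) t1 u t3 v h1 (by linarith) (by linarith)
    have a23 := fun u v => sep (A j) (hA j) t2 u t3 v (by linarith) (by linarith) (by linarith)
    have c12 := fun u v => sep (B j) (hB j) t1 u t2 v h1 (by linarith) (by linarith)
    have c13 := fun u v => sep (B j) (hB j) t1 u t3 v h1 (by linarith) (by linarith)
    have c23 := fun u v => sep (B j) (hB j) t2 u t3 v (by linarith) (by linarith) (by linarith)
    by_cases m1 : t1 ∈ A j <;> by_cases m2 : t2 ∈ A j <;> by_cases m3 : t3 ∈ A j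
    all_goals
      first
      | exact a12 m1 m2
      | exact a13 m1 m3
      | exact a23 m2 m3
      | exact c12 (b1 m1) (b2 m2)
      | exact c13 (b1 m1) (b3 m3)
      | exact c23 (b2 m2) (b3 m3)
  choose! f hf1 hf2 hf3 using step
  let p : ℕ → ℝ := fun n => Nat.rec 1 (fun j q => f j q) n
  have hp0 : p 0 = 1 := rfl
  have hps : ∀ j, p (j + 1) = f j (p j) := fun j => rfl
  have hinv : ∀ j, 1 ≤ p j ∧ p j + (1 / 4 : ℝ) ^ j ≤ 2 := by
    intro j
    induction j with
    | zero => rw [hp0]; norm_num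
    | succ j ih =>
      rw [hps]
      exact ⟨ih.1.trans (hf1 j _ ih.1 ih.2), (hf2 j _ ih.1 ih.2).trans ih.2⟩
  have hmono : Monotone p := monotone_nat_of_le_succ fun j => hf1 j _ (hinv j).1 (hinv j).2
  have hanti : Antitone fun j => p j + (1 / 4 : ℝ) ^ j :=
    antitone_nat_of_succ_le fun j => hf2 j _ (hinv j).1 (hinv j).2
  have hmem := hmono.ciSup_mem_iInter_Icc_of_antitone hanti
    (fun j => by have : (0 : ℝ) < (1 / 4 : ℝ) ^ j := by positivity
                 simp only; linarith)
  rw [Set.mem_iInter] at hmem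
  refine ⟨_, ⟨(hinv 0).1.trans (hmem 0).1, (hmem 0).2.trans (hinv 0).2⟩, fun j => ?_⟩
  exact hf3 j _ (hinv j).1 (hinv j).2 _ (hmem (j + 1))

namespace OrbitSystem

variable {w : ℝ} {S : Set ℝ} {σ : ℝ → ℝ}

theorem pos (H : OrbitSystem w S σ) : 0 < w := one_pos.trans_le H.one_le

theorem conj_ne (H : OrbitSystem w S σ) {β : ℝ} (hβ : β ∈ S) : β - σ β ≠ 0 := by
  obtain ⟨a, b, c, h, -⟩ := H.pair β hβ
  intro h0
  rw [h0, mul_zero] at h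
  exact H.pos.ne h

theorem gap_pos (H : OrbitSystem w S σ) {β : ℝ} (hβ : β ∈ S) : 0 < |β - σ β| :=
  abs_pos.2 (H.conj_ne hβ)

theorem gap_conj (H : OrbitSystem w S σ) {β : ℝ} (hβ : β ∈ S) : |σ β - σ (σ β)| = |β - σ β| := by
  rw [H.conj_conj β hβ, abs_sub_comm]

theorem separation (H : OrbitSystem w S σ) {β γ : ℝ} (hβ : β ∈ S) (hγ : γ ∈ S) (h : β ≠ γ) :
    |β - σ β| * |γ - σ γ| ≤
      2 * w ^ 2 * (|β - γ| * (|β - γ| + |β - σ β| + |γ - σ γ|)) := by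
  have hne : σ β ≠ σ γ := by
    intro e
    apply h
    rw [← H.conj_conj β hβ, e, H.conj_conj γ hγ]
  refine (ConjPair.separation H.pos (H.pair β hβ) (H.pair γ hγ) h hne).trans ?_
  have : |σ β - σ γ| ≤ |β - γ| + |β - σ β| + |γ - σ γ| := by
    have e : σ β - σ γ = (β - γ) - (β - σ β) + (γ - σ γ) := by ring
    rw [e]
    exact (abs_add_le _ _).trans (add_le_add_left (abs_sub _ _) _)
  gcongr

/-- Near a curve of bounded slope, the neighbourhoods of the points of `S` of a given size are
far apart. -/
theorem sparse_level (H : OrbitSystem w S σ) {κ X : ℝ} (hX : 0 < X)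
    (hκ : κ * (32000 * w ^ 2) ≤ 1) (φ : ℝ → ℝ)
    (hlo : ∀ s ∈ Set.Icc (1 : ℝ) 2, ∀ t ∈ Set.Icc (1 : ℝ) 2, X * |s - t| ≤ 13 * |φ s - φ t|)
    (hhi : ∀ s ∈ Set.Icc (1 : ℝ) 2, ∀ t ∈ Set.Icc (1 : ℝ) 2, |φ s - φ t| ≤ X * |s - t|)
    {l s t : ℝ} (hl : 0 < l)
    (hs : ∃ β ∈ S, 16 * w ^ 2 * (X * l) < |β - σ β| ∧ |β - σ β| ≤ 64 * w ^ 2 * (X * l) ∧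
      |φ s - β| < κ * |β - σ β|)
    (ht : ∃ β ∈ S, 16 * w ^ 2 * (X * l) < |β - σ β| ∧ |β - σ β| ≤ 64 * w ^ 2 * (X * l) ∧
      |φ t - β| < κ * |β - σ β|)
    (hs1 : s ∈ Set.Icc (1 : ℝ) 2) (ht1 : t ∈ Set.Icc (1 : ℝ) 2) (hst : |s - t| ≤ l) :
    |s - t| < l / 8 := by
  obtain ⟨β, hβ, hβ1, hβ2, hβ3⟩ := hs
  obtain ⟨γ, hγ, hγ1, hγ2, hγ3⟩ := ht
  have hw := H.one_le
  have hw2 : 1 ≤ w ^ 2 := one_le_pow₀ hw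
  have hL : 0 < X * l := mul_pos hX hl
  have hκ0 : 0 < κ := by
    by_contra hneg
    push Not at hneg
    have := abs_nonneg (φ s - β)
    nlinarith [abs_nonneg (β - σ β)]
  have small : ∀ d, d ≤ 64 * w ^ 2 * (X * l) → κ * d ≤ X * l / 500 := by
    intro d hd
    calc κ * d ≤ κ * (64 * w ^ 2 * (X * l)) := by gcongr
      _ = κ * (32000 * w ^ 2) * (X * l / 500) := by ring
      _ ≤ 1 * (X * l / 500) := by gcongr
      _ = _ := one_mul _
  have s1 := small _ hβ2
  have s2 := small _ hγ2
  have hd := hlo s hs1 t ht1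
  have hd' := hhi s hs1 t ht1
  by_cases hbg : β = γ
  -- Both `φ s` and `φ t` are within `X l / 500` of the same point, and `13 * 2 / 500 < 1 / 8`.
  · subst hbg
    have h1 : |φ s - φ t| ≤ |φ s - β| + |φ t - β| := by
      rw [abs_sub_comm (φ t)]; exact abs_sub_le _ _ _
    have : X * |s - t| < X * (l / 8) := by nlinarith
    exact lt_of_mul_lt_mul_left this hX.le
  -- Distinct `β`, `γ` would be within `2 X l` of each other while both gaps exceed `16 w ^ 2 X l`,
  -- which contradicts separation.
  · exfalso
    have hsep := H.separation hβ hγ hbg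
    have h1 : |β - γ| ≤ |φ s - β| + |φ s - φ t| + |φ t - γ| := by
      have e : β - γ = -(φ s - β) + (φ s - φ t) + (φ t - γ) := by ring
      rw [e]
      refine (abs_add_le _ _).trans (add_le_add_left ((abs_add_le _ _).trans ?_) _)
      rw [abs_neg]
    have h2 : X * |s - t| ≤ X * l := by gcongr
    have h3 : |β - γ| ≤ 2 * (X * l) := by linarith
    set r := |β - γ|
    set d := |β - σ β|
    set e := |γ - σ γ|
    have hr : 0 ≤ r := abs_nonneg _
    have hd0 : 16 * (X * l) ≤ d := by nlinarith
    have he0 : 16 * (X * l) ≤ e := by nlinarith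
    have h4 : 16 * w ^ 2 * (X * l) * (d + e) ≤ 2 * (d * e) := by nlinarith
    have h5 : r * (r + d + e) ≤ 2 * (X * l) * (2 * (d + e)) := by
      apply mul_le_mul h3 (by linarith) (by linarith) (by linarith)
    have h6 : 2 * (2 * w ^ 2 * (r * (r + d + e))) ≤ 16 * w ^ 2 * (X * l) * (d + e) := by
      have := mul_le_mul_of_nonneg_left h5 (by positivity : (0 : ℝ) ≤ 4 * w ^ 2)
      nlinarith
    have h7 : 16 * w ^ 2 * (X * l) * (d + e) < 2 * (d * e) := by nlinarith
    linarith

/-- Sorts gaps into the geometric size classes that index the bad sets. -/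
theorem exists_level {g X v : ℝ} (hg : 0 < g) (hX : 0 < X) (hv : 0 < v) (h : g ≤ 64 * v * X) :
    ∃ j : ℕ, 16 * v * (X * (1 / 4 : ℝ) ^ j) < g ∧ g ≤ 64 * v * (X * (1 / 4 : ℝ) ^ j) := by
  have hp : 0 < 64 * v * X := by positivity
  obtain ⟨j, h1, h2⟩ := exists_nat_pow_near_of_lt_one (div_pos hg hp) ((div_le_one hp).2 h)
    (by norm_num : (0 : ℝ) < 1 / 4) (by norm_num)
  rw [lt_div_iff₀ hp, pow_succ] at h1
  rw [div_le_iff₀ hp] at h2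
  exact ⟨j, by linarith, by linarith⟩

/-- There are two points at a prescribed cross ratio from the conjugates of `α` that are badly
approximable by all the other elements of the orbit. -/
theorem exists_pair_badly_approximable (H : OrbitSystem w S σ) {α : ℝ} (hα : α ∈ S)
    (hlt : σ α < α) (hmax : ∀ β ∈ S, |β - σ β| ≤ α - σ α) {c κ : ℝ} (hc : 0 < c) (hc1 : c ≤ 1)
    (hκ : κ * (32000 * w ^ 2) ≤ 1) :
    ∃ x y : ℝ, α + (α - σ α) ≤ y ∧ y ≤ α + 2 * (α - σ α) ∧ α < x ∧ x ≤ α + c * (α - σ α) / 2 ∧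
      2 * ((x - α) * (y - σ α)) = c * (α - σ α) * (y - x) ∧
      (∀ β ∈ S, β ≠ α → κ * |β - σ β| ≤ |x - β|) ∧ ∀ β ∈ S, κ * |β - σ β| ≤ |y - β| := by
  have hw := H.one_le
  have hw2 : 1 ≤ w ^ 2 := one_le_pow₀ hw
  set d := α - σ α with hd
  have hd0 : 0 < d := sub_pos.2 hlt
  set X := c * d / 2 with hX
  have hX0 : 0 < X := by positivity
  -- `φ η` is the solution `x` of the cross ratio equation for `y = ψ η`. One parameter moves both
  -- points, so the bad sets of `x` and of `y` must be avoided simultaneously.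
  let φ : ℝ → ℝ := fun η => α + X * η / (1 + c / 2 + η)
  let ψ : ℝ → ℝ := fun η => α + d * η
  have hden : ∀ s ∈ Set.Icc (1 : ℝ) 2, 0 < 1 + c / 2 + s := fun s hs => by
    have := hs.1; linarith
  have hφ : ∀ s ∈ Set.Icc (1 : ℝ) 2, ∀ t ∈ Set.Icc (1 : ℝ) 2, |φ s - φ t| =
      X * |s - t| * ((1 + c / 2) / ((1 + c / 2 + s) * (1 + c / 2 + t))) := by
    intro s hs t ht
    have h1 := hden s hs
    have h2 := hden t ht
    have : φ s - φ t =
        X * (s - t) * ((1 + c / 2) / ((1 + c / 2 + s) * (1 + c / 2 + t))) := by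
      simp only [φ]
      generalize 1 + c / 2 = k at h1 h2
      field_simp
      ring
    rw [this, abs_mul, abs_mul, abs_of_pos hX0,
      abs_of_pos (div_pos (by linarith) (mul_pos h1 h2))]
  obtain ⟨η, hη, hbad⟩ := exists_forall_not_mem_of_sparse
    (fun j => {t | ∃ β ∈ S, 16 * w ^ 2 * (X * (1 / 4 : ℝ) ^ j) < |β - σ β| ∧
      |β - σ β| ≤ 64 * w ^ 2 * (X * (1 / 4 : ℝ) ^ j) ∧ |φ t - β| < κ * |β - σ β|})
    (fun j => {t | ∃ β ∈ S, 16 * w ^ 2 * (d * (1 / 4 : ℝ) ^ j) < |β - σ β| ∧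
      |β - σ β| ≤ 64 * w ^ 2 * (d * (1 / 4 : ℝ) ^ j) ∧ |ψ t - β| < κ * |β - σ β|})
    (fun j s hs t ht hs1 ht1 hst => by
      refine H.sparse_level hX0 hκ φ ?_ ?_ (by positivity) hs ht hs1 ht1 hst
      · intro s hs t ht
        rw [hφ s hs t ht]
        have h1 := hden s hs
        have h2 := hden t ht
        -- The numerator is at least `1` and the denominator at most `(7 / 2) ^ 2 < 13`.
        have : 1 / 13 ≤ (1 + c / 2) / ((1 + c / 2 + s) * (1 + c / 2 + t)) := by
          rw [div_le_div_iff₀ (by norm_num) (mul_pos h1 h2)]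
          have h3 : (1 + c / 2 + s) * (1 + c / 2 + t) ≤ (3 + c / 2) * (3 + c / 2) := by
            apply mul_le_mul _ _ h2.le (by linarith) <;> linarith [hs.2, ht.2]
          nlinarith
        have h4 : 0 ≤ X * |s - t| := by positivity
        nlinarith
      · intro s hs t ht
        rw [hφ s hs t ht]
        have h1 := hden s hs
        have h2 := hden t ht
        apply mul_le_of_le_one_right (by positivity)
        rw [div_le_one (mul_pos h1 h2)]
        have h3 : (1 + c / 2) * 1 ≤ (1 + c / 2 + s) * (1 + c / 2 + t) := by
          apply mul_le_mul _ _ (by norm_num) h1.le <;> linarith [hs.1, ht.1]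
        linarith)
    (fun j s hs t ht hs1 ht1 hst => by
      have e : ∀ s t, |ψ s - ψ t| = d * |s - t| := by
        intro s t
        have : ψ s - ψ t = d * (s - t) := by simp only [ψ]; ring
        rw [this, abs_mul, abs_of_pos hd0]
      refine H.sparse_level hd0 hκ ψ ?_ ?_ (by positivity) hs ht hs1 ht1 hst
      · intro s _ t _
        rw [e]
        have : 0 ≤ d * |s - t| := by positivity
        linarith
      · intro s _ t _
        rw [e])
  have hη1 := hη.1
  have hη2 := hη.2
  have hdη := hden η hη
  have hxle : φ η ≤ α + X := by
    simp only [φ]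
    have : X * η / (1 + c / 2 + η) ≤ X := by
      rw [div_le_iff₀ hdη]; nlinarith
    linarith
  have hxgt : α < φ η := by
    simp only [φ]
    have : 0 < X * η / (1 + c / 2 + η) := by positivity
    linarith
  refine ⟨φ η, ψ η, by simp only [ψ]; nlinarith, by simp only [ψ]; nlinarith, hxgt, hxle, ?_,
    ?_, ?_⟩
  · simp only [φ, ψ, hX]
    have : σ α = α - d := by rw [hd]; ring
    rw [this]
    field_simp
    ring
  · intro β hβ hne
    by_contra hcon
    push Not at hcon
    rcases le_or_gt |β - σ β| (64 * w ^ 2 * X) with hle | hgt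
    · obtain ⟨j, h1, h2⟩ := exists_level (H.gap_pos hβ) hX0 (by positivity) hle
      exact (hbad j).1 ⟨β, hβ, h1, h2, hcon⟩
    -- Here `β` is too large for the levels attached to `x`. As `x` is close to `α`, it would lie
    -- within `g / (32 w ^ 2)` of `α`, which separation from `α` and maximality of `d` forbid.
    · have hsep := H.separation hα hβ hne.symm
      have hm := hmax β hβ
      have hαd : |α - σ α| = d := abs_of_pos hd0
      rw [hαd] at hsep
      have h1 : |α - β| ≤ X + |φ η - β| := by
        have := abs_sub_le α (φ η) β
        have e : |α - φ η| ≤ X := by rw [abs_le]; constructor <;> linarith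
        linarith
      have hg := H.gap_pos hβ
      set g := |β - σ β|
      have h2 : |α - β| * (32 * w ^ 2) ≤ g := by
        have : κ * g * (32000 * w ^ 2) ≤ g := by nlinarith
        have : |α - β| * (32000 * w ^ 2) ≤ (X + κ * g) * (32000 * w ^ 2) := by
          gcongr; linarith
        nlinarith
      have h3 : |α - β| ≤ g := by nlinarith [abs_nonneg (α - β)]
      have h4 : |α - β| * (32 * w ^ 2) * (|α - β| + d + g) ≤ g * (3 * d) := by
        apply mul_le_mul h2 (by linarith) (by positivity) hg.le
      nlinarith [mul_pos hd0 hg]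
  · intro β hβ
    by_contra hcon
    push Not at hcon
    obtain ⟨j, h1, h2⟩ := exists_level (v := w ^ 2) (H.gap_pos hβ) hd0 (by positivity)
      ((hmax β hβ).trans (by nlinarith))
    exact (hbad j).2 ⟨β, hβ, h1, h2, hcon⟩

end OrbitSystem

/-! ### Rationals with a prescribed constant over the whole orbit -/

theorem moebius_moebius_inv (g : Matrix.SpecialLinearGroup (Fin 2) ℤ) {x : ℝ}
    (hx : Irrational x) : moebius g (moebius g⁻¹ x) = x := by
  simpa using moebius_inv_moebius g⁻¹ hx

/-- Invariance of the cross ratio when the pole `y` is moved to infinity. -/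
theorem moebius_cross (g : Matrix.SpecialLinearGroup (Fin 2) ℤ) {x y γ γ' : ℝ}
    (hg : (g.1 1 0 : ℝ) ≠ 0) (hy : (g.1 1 0 : ℝ) * y + g.1 1 1 = 0) (hx : x ≠ y) (hγ : γ ≠ y)
    (hγ' : γ' ≠ y) :
    |moebius g x - moebius g γ| * (|x - y| * |γ - γ'|) =
      |moebius g γ - moebius g γ'| * (|x - γ| * |y - γ'|) := by
  have e : ∀ z : ℝ, (g.1 1 0 : ℝ) * z + g.1 1 1 = g.1 1 0 * (z - y) := fun z => by
    linear_combination hy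
  have hx' := sub_ne_zero.2 hx
  have h1 := sub_ne_zero.2 hγ
  have h2 := sub_ne_zero.2 hγ'
  have n1 : (g.1 1 0 : ℝ) * x + g.1 1 1 ≠ 0 := by rw [e]; exact mul_ne_zero hg hx'
  have n2 : (g.1 1 0 : ℝ) * γ + g.1 1 1 ≠ 0 := by rw [e]; exact mul_ne_zero hg h1
  have n3 : (g.1 1 0 : ℝ) * γ' + g.1 1 1 ≠ 0 := by rw [e]; exact mul_ne_zero hg h2
  rw [moebius_sub g n1 n2, moebius_sub g n2 n3, e, e, e]
  rw [← abs_mul, ← abs_mul, ← abs_mul, ← abs_mul, ← abs_neg]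
  congr 1
  generalize (g.1 1 0 : ℝ) = r at hg
  field_simp
  ring

namespace OrbitSystem

variable {w : ℝ} {S : Set ℝ} {σ : ℝ → ℝ}

theorem rat_ne (H : OrbitSystem w S σ) {β : ℝ} (hβ : β ∈ S) (z : ℚ) : β ≠ (z : ℝ) :=
  (H.irr β hβ).ne_rat z

theorem gap_le_of_rat (H : OrbitSystem w S σ) {β : ℝ} (hβ : β ∈ S) (z : ℚ) :
    |β - σ β| ≤ w * z.den ^ 2 * (|z - β| * |z - σ β|) :=
  (H.pair β hβ).le_of_rat H.pos z (H.rat_ne hβ z).symm (H.rat_ne (H.conj_mem β hβ) z).symm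

/-- Dirichlet approximations `q` of `z` inherit the property. For gaps large compared with `1 /
q.den ^ 2`, the point `q` is close enough to `z`; for smaller gaps, the nonzero value of the
integral form at `q` already keeps `q` away from its roots. -/
theorem exists_rat_badly_approximable (H : OrbitSystem w S σ) {P : ℝ → Prop} {z κ : ℝ}
    (hκ : 0 < κ) (hκ1 : κ ≤ 1) (hz : ∀ β ∈ S, P β → κ * |β - σ β| ≤ |z - β|) {η : ℝ}
    (hη : 0 < η) :
    ∃ q : ℚ, |z - q| < η ∧ ∀ β ∈ S, P β → κ / (4 * w) * |β - σ β| ≤ |q - β| := by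
  obtain ⟨n, hn⟩ := exists_nat_one_div_lt hη
  obtain ⟨q, hq1, hq2⟩ := Real.exists_rat_abs_sub_le_and_den_le z (Nat.succ_pos n)
  have hw := H.one_le
  have hw0 := H.pos
  have hden : (1 : ℝ) ≤ q.den := by exact_mod_cast q.den_pos
  have hq2' : (q.den : ℝ) ≤ n + 1 := by exact_mod_cast hq2
  push_cast at hq1
  have hq3 : |z - q| ≤ 1 / (q.den : ℝ) ^ 2 := by
    refine hq1.trans (one_div_le_one_div_of_le (by positivity) ?_)
    rw [sq]; gcongr; linarith
  refine ⟨q, ?_, ?_⟩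
  · refine (hq1.trans (one_div_le_one_div_of_le (by positivity) ?_)).trans_lt hn
    nlinarith
  · intro β hβ hP
    have h := hz β hβ hP
    have hrat := H.gap_le_of_rat hβ q
    have hg := H.gap_pos hβ
    set d := |β - σ β|
    have hle : κ / (4 * w) ≤ κ / 4 := by gcongr; linarith
    rcases le_or_gt 2 (d * q.den ^ 2 * κ) with h2 | h2
    · have h3 : 1 / (q.den : ℝ) ^ 2 ≤ κ * d / 2 := by
        rw [div_le_iff₀ (by positivity)]; linarith
      have h4 := abs_sub_le z q β
      nlinarith
    · rcases le_or_gt d |q - β| with h3 | h3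
      · refine le_trans ?_ h3
        nlinarith
      · have h4 : |q - σ β| ≤ 2 * d := by
          have := abs_sub_le (q : ℝ) β (σ β)
          linarith
        have h5 : d ≤ w * q.den ^ 2 * (|q - β| * (2 * d)) := hrat.trans (by gcongr)
        have h6 : 1 ≤ w * q.den ^ 2 * (|q - β| * 2) := by
          have : d * 1 ≤ d * (w * q.den ^ 2 * (|q - β| * 2)) := by linarith
          exact le_of_mul_le_mul_left this hg
        have h7 : κ / (4 * w) * d ≤ κ / (4 * w) * d * (w * q.den ^ 2 * (|q - β| * 2)) :=
          le_mul_of_one_le_right (by positivity) h6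
        refine h7.trans ?_
        have e : κ / (4 * w) * d * (w * q.den ^ 2 * (|q - β| * 2)) =
            (d * q.den ^ 2 * κ) / 2 * |q - β| := by
          field_simp
          ring
        rw [e]
        exact mul_le_of_le_one_left (abs_nonneg _) (by linarith)

/-- Each gap is `w / |a|` with `a` a nonzero integer, so the least `|a|` gives the largest gap. -/
theorem exists_maximal_gap (H : OrbitSystem w S σ) :
    ∃ α ∈ S, σ α < α ∧ ∀ β ∈ S, |β - σ β| ≤ α - σ α := by
  have hex : ∀ β ∈ S, ∃ n : ℕ, n ≠ 0 ∧ n * |β - σ β| = w := by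
    intro β hβ
    obtain ⟨a, b, c, h, -⟩ := H.pair β hβ
    refine ⟨a.natAbs, ?_, ?_⟩
    · intro h0
      rw [Int.natAbs_eq_zero] at h0
      rw [h0] at h
      have := H.pos
      simp at h
      linarith
    · rw [Nat.cast_natAbs, Int.cast_abs, ← abs_mul, h, abs_of_pos H.pos]
  classical
  have hne : ∃ n : ℕ, ∃ β ∈ S, n ≠ 0 ∧ n * |β - σ β| = w := by
    obtain ⟨β, hβ⟩ := H.nonempty
    obtain ⟨n, hn⟩ := hex β hβ
    exact ⟨n, β, hβ, hn⟩
  obtain ⟨α, hα, hn0, hn⟩ := Nat.find_spec hne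
  have hmax : ∀ β ∈ S, |β - σ β| ≤ |α - σ α| := by
    intro β hβ
    obtain ⟨m, hm0, hm⟩ := hex β hβ
    have hle : (Nat.find hne : ℝ) ≤ m := by
      exact_mod_cast Nat.find_min' hne ⟨β, hβ, hm0, hm⟩
    have hpos : (0 : ℝ) < Nat.find hne := by exact_mod_cast Nat.pos_of_ne_zero hn0
    refine le_of_mul_le_mul_left ?_ hpos
    calc _ ≤ (m : ℝ) * |β - σ β| := by gcongr
      _ = _ := hm.trans hn.symm
  rcases lt_or_gt_of_ne (sub_ne_zero.1 (H.conj_ne hα)) with h | h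
  · refine ⟨σ α, H.conj_mem α hα, by rwa [H.conj_conj α hα], fun β hβ => ?_⟩
    rw [H.conj_conj α hα]
    have := hmax β hβ
    rwa [abs_sub_comm α, abs_of_pos (sub_pos.2 h)] at this
  · refine ⟨α, hα, h, fun β hβ => ?_⟩
    have := hmax β hβ
    rwa [abs_of_pos (sub_pos.2 h)] at this

/-- Guarantees that no other orbit element competes with `α` once `y` is sent to infinity. If one of
the factors `|x - γ|`, `|y - σ γ|` is a fixed fraction of `d`, bad approximability bounds the other.
If both are small, the gap of `γ` is comparable to `d`, and separation from `α` keeps `γ` away from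
`x`. -/
theorem cross_ratio_lower_bound (H : OrbitSystem w S σ) {α : ℝ} (hα : α ∈ S) {d κ x y : ℝ}
    (hd : |α - σ α| = d) (hmax : ∀ β ∈ S, |β - σ β| ≤ d) (hκ : 0 < κ)
    (hx : |x - α| * (100 * w ^ 2) ≤ d) (hxy1 : 9 / 10 * d ≤ |x - y|) (hxy2 : |x - y| ≤ 21 / 10 * d)
    (hNx : ∀ β ∈ S, β ≠ α → κ * |β - σ β| ≤ |x - β|)
    (hNy : ∀ β ∈ S, κ * |β - σ β| ≤ |y - β|) {γ : ℝ} (hγ : γ ∈ S) (hne : γ ≠ α) :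
    κ / (130 * w ^ 2) * (|x - y| * |γ - σ γ|) ≤ |x - γ| * |y - σ γ| := by
  have hw2 : 1 ≤ w ^ 2 := one_le_pow₀ H.one_le
  have hd0 : 0 < d := hd ▸ H.gap_pos hα
  have hg := H.gap_pos hγ
  have h1 := hNx γ hγ hne
  have h2 := hNy (σ γ) (H.conj_mem γ hγ)
  rw [H.gap_conj hγ] at h2
  have hsep := H.separation hα hγ hne.symm
  have hgd := hmax γ hγ
  rw [hd] at hsep
  have t1 : |x - y| ≤ |x - σ γ| + |y - σ γ| := by
    have := abs_sub_le x (σ γ) y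
    rwa [abs_sub_comm (σ γ) y] at this
  have t2 : |x - σ γ| ≤ |x - γ| + |γ - σ γ| := abs_sub_le _ _ _
  have t3 : |α - γ| ≤ |x - α| + |x - γ| := by
    have := abs_sub_le α x γ
    rwa [abs_sub_comm α x] at this
  have hX := abs_nonneg (x - γ)
  have hY := abs_nonneg (y - σ γ)
  have hxα := abs_nonneg (x - α)
  have hαγ := abs_nonneg (α - γ)
  generalize |x - γ| = A at *
  generalize |y - σ γ| = C at *
  generalize |γ - σ γ| = g at *
  generalize |x - y| = L at *
  generalize |x - α| = u at *
  generalize |α - γ| = r at *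
  generalize |x - σ γ| = M at *
  have key : κ / (130 * w ^ 2) * (L * g) ≤ κ * g * d / (60 * w ^ 2) := by
    rw [div_mul_eq_mul_div, div_le_div_iff₀ (by positivity) (by positivity)]
    have : κ * (L * g) ≤ κ * (21 / 10 * d * g) := by gcongr
    have h3 := mul_le_mul_of_nonneg_right this (by positivity : 0 ≤ 60 * w ^ 2)
    have h4 : 0 ≤ κ * g * d * w ^ 2 := by positivity
    linarith
  refine key.trans ?_
  have weaken : κ * g * d / (60 * w ^ 2) ≤ κ * g * d / 60 := by
    gcongr; linarith
  rcases le_or_gt (d / 2) C with hC | hC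
  · have : κ * g * (d / 2) ≤ A * C := by gcongr
    have : 0 ≤ κ * g * d := by positivity
    linarith
  · rcases le_or_gt (d / 5) A with hA | hA
    · have : d / 5 * (κ * g) ≤ A * C := by gcongr
      have : 0 ≤ κ * g * d := by positivity
      linarith
    · have hg1 : d / 5 ≤ g := by linarith
      have hu : u ≤ d / 100 := by nlinarith
      have hr : r ≤ d := by linarith
      have h3 : d * g ≤ 2 * w ^ 2 * (r * (3 * d)) := hsep.trans (by gcongr; linarith)
      have h4 : g ≤ 6 * w ^ 2 * r := by
        refine le_of_mul_le_mul_left ?_ hd0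
        linarith
      have h5 : g ≤ 12 * w ^ 2 * A := by nlinarith
      have h6 : d / (60 * w ^ 2) ≤ A := by
        rw [div_le_iff₀ (by positivity)]; linarith
      calc κ * g * d / (60 * w ^ 2) = d / (60 * w ^ 2) * (κ * g) := by ring
        _ ≤ A * C := by gcongr

/-- For every small `c` there are rational numbers whose best approximation constant, over the
whole orbit, is as close to `c` as we like. -/
theorem exists_rat_approx_const (H : OrbitSystem w S σ) {c ε : ℝ} (hc : 0 < c)
    (hcw : c * (10 ^ 7 * w ^ 5) ≤ 1) (hε : 0 < ε) :
    ∃ t : ℚ, (∀ β ∈ S, (c - ε) * |β - σ β| ≤ 2 * |t - β|) ∧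
      ∃ β ∈ S, |2 * |t - β| - (c * |β - σ β|)| < ε * |β - σ β| := by
  obtain ⟨α, hα, hlt, hmax⟩ := H.exists_maximal_gap
  have hw := H.one_le
  have hw0 := H.pos
  have hw2 : 1 ≤ w ^ 2 := one_le_pow₀ hw
  have hw3 : 1 ≤ w ^ 3 := one_le_pow₀ hw
  have hw5 : w ^ 2 ≤ w ^ 5 := pow_le_pow_right₀ hw (by norm_num)
  have hc2 : c * (10 ^ 7 * w ^ 2) ≤ 1 := le_trans (by gcongr) hcw
  have hc1 : c ≤ 1 := by nlinarith
  obtain ⟨x, y, hy1, hy2, hx1, hx2, hxy, hNx, hNy⟩ := H.exists_pair_badly_approximable hα hlt hmax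
    hc hc1 (κ := 1 / (32000 * w ^ 2)) (by rw [one_div_mul_cancel]; positivity)
  set κ := 1 / (32000 * w ^ 2) with hκ
  have hκ0 : 0 < κ := by positivity
  have hκ1 : κ ≤ 1 := by
    rw [hκ, div_le_one (by positivity)]; linarith
  set d := α - σ α with hd
  have hd0 : 0 < d := sub_pos.2 hlt
  have hdabs : |α - σ α| = d := abs_of_pos hd0
  have hcd : c * d * (10 ^ 7 * w ^ 2) ≤ d := by nlinarith
  have hcd' : c * d ≤ d / 10 ^ 7 := by
    have : c * d ≤ c * d * w ^ 2 := le_mul_of_one_le_right (by positivity) hw2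
    linarith
  have hyx : y - x ≠ 0 := by linarith
  have hcont : ContinuousAt (fun p : ℝ × ℝ => 2 * (|p.1 - α| * |p.2 - σ α|) / |p.2 - p.1|) (x, y) :=
    ContinuousAt.div (by fun_prop) (by fun_prop) (abs_ne_zero.2 hyx)
  obtain ⟨δ, hδ, hnear⟩ := Metric.continuousAt_iff.1 hcont (ε * d) (by positivity)
  have hval : 2 * (|x - α| * |y - σ α|) / |y - x| = c * d := by
    rw [abs_of_pos (sub_pos.2 hx1), abs_of_pos (by linarith : 0 < y - σ α),
      abs_of_pos (by linarith : 0 < y - x), hxy, mul_div_assoc, div_self hyx, mul_one]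
  simp only [hval] at hnear
  have hη : (0 : ℝ) < min δ (d / (400 * w ^ 2)) := by positivity
  obtain ⟨x', hx', hNx'⟩ := H.exists_rat_badly_approximable (P := fun β => β ≠ α) hκ0 hκ1 hNx hη
  obtain ⟨y', hy', hNy'⟩ := H.exists_rat_badly_approximable (P := fun _ => True) hκ0 hκ1
    (fun β hβ _ => hNy β hβ) hη
  rw [lt_min_iff] at hx' hy'
  have hsmall : d / (400 * w ^ 2) ≤ d / 400 := by gcongr; linarith
  have hnear' := @hnear (x', y') (by
    rw [Prod.dist_eq, max_lt_iff, Real.dist_eq, Real.dist_eq, abs_sub_comm, abs_sub_comm (y' : ℝ)]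
    exact ⟨hx'.1, hy'.1⟩)
  rw [Real.dist_eq] at hnear'
  simp only at hnear'
  obtain ⟨hxl, hxr⟩ := abs_lt.1 hx'.2
  obtain ⟨hyl, hyr⟩ := abs_lt.1 hy'.2
  have hyx' : (0 : ℝ) < y' - x' := by linarith
  have hxα : |(x' : ℝ) - α| * (100 * w ^ 2) ≤ d := by
    have h1 : |(x' : ℝ) - α| ≤ c * d / 2 + d / (400 * w ^ 2) := by
      rw [abs_le]; constructor <;> linarith
    have h2 : d / (400 * w ^ 2) * (100 * w ^ 2) = d / 4 := by field_simp; norm_num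
    calc |(x' : ℝ) - α| * (100 * w ^ 2)
        ≤ (c * d / 2 + d / (400 * w ^ 2)) * (100 * w ^ 2) := by gcongr
      _ = c * d * (50 * w ^ 2) + d / 4 := by rw [add_mul, h2]; ring
      _ ≤ d := by linarith
  have hxyabs : |(x' : ℝ) - y'| = y' - x' := by rw [abs_sub_comm, abs_of_pos hyx']
  have hκ'0 : 0 < κ / (4 * w) := by positivity
  have hκ'1 : κ / (4 * w) ≤ 1 := by
    rw [div_le_one (by positivity)]; linarith
  have hlow : ∀ γ ∈ S, γ ≠ α → _ := fun γ hγ hne =>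
    H.cross_ratio_lower_bound hα (x := x') (y := y') hdabs hmax hκ'0 hxα
      (by rw [hxyabs]; linarith) (by rw [hxyabs]; linarith) hNx' (fun β hβ => hNy' β hβ trivial)
      hγ hne
  -- Source of the factor `10 ^ 7 * w ^ 5`: the losses multiply to `32000 * 4 * 130 * w ^ 5 =
  -- 16640000 * w ^ 5`, which is below `2 * 10 ^ 7 * w ^ 5`.
  have hconst : c / 2 ≤ κ / (4 * w) / (130 * w ^ 2) := by
    rw [hκ, div_div, div_div, div_le_div_iff₀ (by norm_num) (by positivity)]
    have e : 32000 * w ^ 2 * (4 * w * (130 * w ^ 2)) = 16640000 * w ^ 5 := by ring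
    rw [e]
    linarith
  have hlow' : ∀ γ ∈ S, (c - ε) * (|(x' : ℝ) - y'| * |γ - σ γ|) ≤
      2 * (|(x' : ℝ) - γ| * |(y' : ℝ) - σ γ|) := by
    intro γ hγ
    by_cases hne : γ = α
    · subst hne
      rw [hdabs, hxyabs]
      have h1 := (abs_lt.1 hnear').1
      have h2 : (c - ε) * d < 2 * (|(x' : ℝ) - γ| * |(y' : ℝ) - σ γ|) / |(y' : ℝ) - x'| := by
        linarith
      rw [lt_div_iff₀ (abs_pos.2 hyx'.ne'), abs_of_pos hyx'] at h2
      linarith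
    · have h1 := hlow γ hγ hne
      have h2 : c / 2 * (|(x' : ℝ) - y'| * |γ - σ γ|) ≤
          κ / (4 * w) / (130 * w ^ 2) * (|(x' : ℝ) - y'| * |γ - σ γ|) := by gcongr
      have h3 : 0 ≤ ε * (|(x' : ℝ) - y'| * |γ - σ γ|) := by positivity
      linarith
  have hcop : IsCoprime (y'.den : ℤ) (-y'.num) := by
    have := Rat.isCoprime_num_den y'
    exact this.symm.neg_right
  -- The bottom row is chosen to vanish at `y'`, so `v` sends `y'` to infinity; the rational sought
  -- is `v x'`.
  obtain ⟨v, hv0, hv1⟩ := hcop.exists_SL2_row 1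
  have hv0' : (v.1 1 0 : ℝ) ≠ 0 := by
    rw [hv0]; exact_mod_cast y'.den_ne_zero
  have hvy : (v.1 1 0 : ℝ) * y' + v.1 1 1 = 0 := by
    rw [hv0, hv1]
    have : (y' : ℝ) * y'.den = y'.num := by exact_mod_cast Rat.mul_den_eq_num y'
    push_cast
    linarith
  have hcross : ∀ γ ∈ S, _ := fun γ hγ => moebius_cross v (x := x') (y := y') (γ := γ) (γ' := σ γ)
    hv0' hvy (by linarith) (H.rat_ne hγ y') (H.rat_ne (H.conj_mem γ hγ) y')
  have hvx : ∃ t : ℚ, (t : ℝ) = moebius v x' :=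
    ⟨(v.1 0 0 * x' + v.1 0 1) / (v.1 1 0 * x' + v.1 1 1), by push_cast; rfl⟩
  obtain ⟨t, ht⟩ := hvx
  have hpos : ∀ γ ∈ S, 0 < |(x' : ℝ) - y'| * |γ - σ γ| := fun γ hγ =>
    mul_pos (by rw [hxyabs]; exact hyx') (H.gap_pos hγ)
  refine ⟨t, ?_, moebius v α, H.moebius_mem v α hα, ?_⟩
  · intro β hβ
    have hγ := H.moebius_mem v⁻¹ β hβ
    have hβγ := moebius_moebius_inv v (H.irr β hβ)
    set γ := moebius v⁻¹ β
    rw [← hβγ, H.conj_moebius v γ hγ, ht]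
    refine le_of_mul_le_mul_right ?_ (hpos γ hγ)
    rw [mul_assoc 2, hcross γ hγ]
    have := mul_le_mul_of_nonneg_left (hlow' γ hγ) (abs_nonneg (moebius v γ - moebius v (σ γ)))
    linarith
  · have h := hcross α hα
    have hgap := H.gap_pos (H.moebius_mem v α hα)
    rw [H.conj_moebius v α hα] at hgap ⊢
    rw [ht]
    rw [hdabs] at h
    have e : 2 * |moebius v x' - moebius v α| = |moebius v α - moebius v (σ α)| *
        (2 * (|(x' : ℝ) - α| * |(y' : ℝ) - σ α|) / |(y' : ℝ) - x'|) / d := by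
      rw [abs_sub_comm (y' : ℝ) (x' : ℝ)]
      have : |(x' : ℝ) - y'| ≠ 0 := by rw [hxyabs]; exact hyx'.ne'
      field_simp
      linarith
    have e2 : 2 * |moebius v x' - moebius v α| - c * |moebius v α - moebius v (σ α)| =
        |moebius v α - moebius v (σ α)| / d *
        (2 * (|(x' : ℝ) - α| * |(y' : ℝ) - σ α|) / |(y' : ℝ) - x'| - c * d) := by
      rw [e]; field_simp
    rw [e2, abs_mul, abs_of_pos (div_pos hgap hd0)]
    calc _ < |moebius v α - moebius v (σ α)| / d * (ε * d) := by
            apply mul_lt_mul_of_pos_left hnear' (div_pos hgap hd0)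
      _ = _ := by field_simp

end OrbitSystem

/-! ### Rationals with a prescribed constant near a given rational -/

theorem moebius_sub_pole (g : Matrix.SpecialLinearGroup (Fin 2) ℤ) {x y : ℝ}
    (hg : (g.1 1 0 : ℝ) ≠ 0) (hy : (g.1 1 0 : ℝ) * y + g.1 1 1 = 0) (hx : x ≠ y) :
    moebius g x - (g.1 0 0 : ℝ) / g.1 1 0 = -1 / ((g.1 1 0 : ℝ) ^ 2 * (x - y)) := by
  have e : (g.1 1 0 : ℝ) * x + g.1 1 1 = g.1 1 0 * (x - y) := by linear_combination hy
  have hx' := sub_ne_zero.2 hx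
  have hd := det_cast g
  have e1 : (g.1 1 1 : ℝ) = -(g.1 1 0 * y) := by linear_combination hy
  rw [moebius, e, div_sub_div _ _ (mul_ne_zero hg hx') hg,
    div_eq_div_iff (mul_ne_zero (mul_ne_zero hg hx') hg) (mul_ne_zero (pow_ne_zero 2 hg) hx')]
  rw [e1] at hd
  linear_combination -((g.1 1 0 : ℝ) ^ 2 * (x - y)) * hd

theorem moebius_gap (g : Matrix.SpecialLinearGroup (Fin 2) ℤ) {γ γ' y : ℝ}
    (hg : (g.1 1 0 : ℝ) ≠ 0) (hy : (g.1 1 0 : ℝ) * y + g.1 1 1 = 0) (hγ : γ ≠ y) (hγ' : γ' ≠ y) :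
    |moebius g γ - moebius g γ'| * ((g.1 1 0 : ℝ) ^ 2 * (|γ - y| * |γ' - y|)) = |γ - γ'| := by
  have e : ∀ z : ℝ, (g.1 1 0 : ℝ) * z + g.1 1 1 = g.1 1 0 * (z - y) := fun z => by
    linear_combination hy
  have h1 := sub_ne_zero.2 hγ
  have h2 := sub_ne_zero.2 hγ'
  have n2 : (g.1 1 0 : ℝ) * γ + g.1 1 1 ≠ 0 := by rw [e]; exact mul_ne_zero hg h1
  have n3 : (g.1 1 0 : ℝ) * γ' + g.1 1 1 ≠ 0 := by rw [e]; exact mul_ne_zero hg h2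
  rw [moebius_sub g n2 n3, e, e, ← abs_mul, ← sq_abs, ← abs_pow, ← abs_mul, ← abs_mul]
  congr 1
  generalize (g.1 1 0 : ℝ) = r at hg
  field_simp

theorem exists_seq_of_step {A : Type*} (P : ℕ → A → Prop) (Q : ℕ → A → A → Prop)
    (h0 : ∃ a, P 0 a) (h : ∀ n a, P n a → ∃ b, P (n + 1) b ∧ Q n a b) :
    ∃ u : ℕ → A, ∀ n, P n (u n) ∧ Q n (u n) (u (n + 1)) := by
  obtain ⟨a, ha⟩ := h0
  have : Nonempty A := ⟨a⟩
  choose! f hf1 hf2 using h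
  let u : ℕ → A := fun n => Nat.rec a (fun k b => f k b) n
  have hu : ∀ n, P n (u n) := by
    intro n
    induction n with
    | zero => exact ha
    | succ n ih => exact hf1 n _ ih
  exact ⟨u, fun n => ⟨hu n, hf2 n _ (hu n)⟩⟩

namespace OrbitSystem

variable {w : ℝ} {S : Set ℝ} {σ : ℝ → ℝ}

theorem add_int (H : OrbitSystem w S σ) {β : ℝ} (hβ : β ∈ S) (n : ℤ) :
    β + n ∈ S ∧ σ (β + n) = σ β + n := by
  let g : Matrix.SpecialLinearGroup (Fin 2) ℤ := ⟨!![1, n; 0, 1], by simp⟩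
  have hg : ∀ x, moebius g x = x + n := by
    intro x
    simp [moebius, g]
  have h1 := H.moebius_mem g β hβ
  have h2 := H.conj_moebius g β hβ
  rw [hg] at h1 h2
  rw [hg] at h2
  exact ⟨h1, h2⟩

/-- Close to a given rational number `r₀` there are rational numbers `r` whose best approximation
constant is close to `c`, only elements of the orbit that are large in terms of `r₀` being
disregarded. -/
theorem exists_rat_near (H : OrbitSystem w S σ) {c ε : ℝ} (hc : 0 < c)
    (hcw : c * (10 ^ 7 * w ^ 5) ≤ 1) (hε : 0 < ε) (r₀ : ℚ) :
    ∃ δ > 0, ∀ ρ > 0, ∃ r : ℚ, |(r : ℝ) - r₀| < ρ ∧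
      (∀ β ∈ S, |β - σ β| < δ → (c - ε) * |β - σ β| ≤ 2 * |r - β|) ∧
      ∃ β ∈ S, |β - σ β| < ρ ∧ |2 * |r - β| - (c * |β - σ β|)| < ε * |β - σ β| := by
  -- The error is spent twice, on `t₀` and on the motion of the pole; `e ≤ c / 2` keeps `c - e`
  -- positive.
  set e := min ε c / 2 with he
  have he0 : 0 < e := by positivity
  have heε : 2 * e ≤ ε := by rw [he]; linarith [min_le_left ε c]
  have hec : 2 * e ≤ c := by rw [he]; linarith [min_le_right ε c]
  obtain ⟨t₀, ht₀, β₀, hβ₀, hβt⟩ := H.exists_rat_approx_const hc hcw he0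
  obtain ⟨α, hα, hlt, hmax⟩ := H.exists_maximal_gap
  have hG0 : 0 < α - σ α := sub_pos.2 hlt
  generalize α - σ α = G at hmax hG0
  -- `v` sends infinity to `r₀`, so `v (t₀ + K)` tends to `r₀` as `K` grows; `y` below is the pole
  -- of `v`.
  obtain ⟨v, hv0, hv1⟩ := (Rat.isCoprime_num_den r₀).exists_SL2_col 0
  have hq : (v.1 1 0 : ℝ) ≠ 0 := by
    rw [hv1]; exact_mod_cast r₀.den_ne_zero
  have hr₀ : (v.1 0 0 : ℝ) / v.1 1 0 = r₀ := by
    rw [hv0, hv1]; exact_mod_cast Rat.num_div_den r₀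
  have hy' : ∃ y : ℚ, (v.1 1 0 : ℝ) * y + v.1 1 1 = 0 := by
    refine ⟨-(v.1 1 1) / v.1 1 0, ?_⟩
    push_cast
    field_simp
    ring
  obtain ⟨y, hy⟩ := hy'
  set q := (v.1 1 0 : ℝ) with hqdef
  have hq2 : 0 < q ^ 2 := by positivity
  set M := c ^ 2 / e with hM
  have hM0 : 0 < M := by positivity
  -- The threshold is fixed before `ρ`, hence before `K`; the later iteration depends on this.
  refine ⟨1 / (q ^ 2 * ((M + 1) * M * G)), by positivity, fun ρ hρ => ?_⟩
  have large : ∀ a C : ℝ, ∀ᶠ K : ℕ in atTop, C ≤ a + K := fun a C =>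
    (tendsto_atTop_add_const_left _ a tendsto_natCast_atTop_atTop).eventually_ge_atTop C
  have hg₀ := H.gap_pos hβ₀
  obtain ⟨K, hK1, hK2, hK3, hK4, hK5, hK6⟩ := ((large (t₀ - y) 1).and <|
    (large (t₀ - y) (2 * G * c / e)).and <|
    (large (t₀ - y) (2 * |t₀ - β₀| * |σ β₀ - t₀| / (e * |β₀ - σ β₀|))).and <|
    (large (t₀ - y) (2 / (q ^ 2 * ρ))).and <|
    (large (β₀ - y) 1).and (large (σ β₀ - y) (2 * |β₀ - σ β₀| / (q ^ 2 * ρ)))).exists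
  have hT0 : 0 < (t₀ + K : ℝ) - y := by linarith
  have hT : |((t₀ + K : ℝ)) - y| = t₀ - y + K := by rw [abs_of_pos hT0]; ring
  have hty : (t₀ + K : ℝ) ≠ y := sub_ne_zero.1 hT0.ne'
  obtain ⟨r, hr⟩ : ∃ r : ℚ, (r : ℝ) = moebius v (t₀ + K) :=
    ⟨(v.1 0 0 * (t₀ + K) + v.1 0 1) / (v.1 1 0 * (t₀ + K) + v.1 1 1), by push_cast; rfl⟩
  have hcross : ∀ γ ∈ S, _ := fun γ hγ => moebius_cross v (x := t₀ + K) (y := y) (γ := γ)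
    (γ' := σ γ) hq hy hty (H.rat_ne hγ y) (H.rat_ne (H.conj_mem γ hγ) y)
  have hgap : ∀ γ ∈ S, _ := fun γ hγ => moebius_gap v (γ := γ) (γ' := σ γ) (y := y) hq hy
    (H.rat_ne hγ y) (H.rat_ne (H.conj_mem γ hγ) y)
  refine ⟨r, ?_, ?_, ?_⟩
  · have := moebius_sub_pole v hq hy hty
    rw [hr₀, ← hr] at this
    rw [this, abs_div, abs_neg, abs_one, abs_mul, hT, abs_of_pos hq2, div_lt_iff₀ (by
      rw [← hT]; positivity)]
    rw [div_le_iff₀ (by positivity)] at hK4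
    linarith
  · intro β hβ hβδ
    have hτ := H.moebius_mem v⁻¹ β hβ
    have hβτ := moebius_moebius_inv v (H.irr β hβ)
    set τ := moebius v⁻¹ β
    have hc1 := hcross τ hτ
    have hg1 := hgap τ hτ
    have hA := ht₀ _ (H.add_int hτ (-K)).1
    rw [(H.add_int hτ (-K)).2] at hA
    have ex : |τ + ((-(K : ℤ) : ℤ) : ℝ) - (σ τ + ((-(K : ℤ) : ℤ) : ℝ))| = |τ - σ τ| := by
      congr 1; ring
    have ex2 : |(t₀ : ℝ) - (τ + ((-(K : ℤ) : ℤ) : ℝ))| = |(t₀ + K : ℝ) - τ| := by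
      congr 1; push_cast; ring
    rw [ex, ex2] at hA
    have hg := H.gap_pos hτ
    have hgG := hmax τ hτ
    rw [← hβτ, H.conj_moebius v τ hτ] at hβδ ⊢
    rw [hr]
    have hdpos : 0 ≤ |moebius v τ - moebius v (σ τ)| := abs_nonneg _
    refine le_of_mul_le_mul_right ?_ (mul_pos (abs_pos.2 hT0.ne') hg)
    rw [mul_assoc 2, hc1]
    suffices h : (c - ε) * (|(t₀ + K : ℝ) - y| * |τ - σ τ|) ≤
        2 * (|(t₀ + K : ℝ) - τ| * |(y : ℝ) - σ τ|) by
      have := mul_le_mul_of_nonneg_left h hdpos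
      linarith
    have hz0 : 0 < |(y : ℝ) - σ τ| :=
      abs_pos.2 (sub_ne_zero.2 (H.rat_ne (H.conj_mem τ hτ) y).symm)
    have hT1 : |(t₀ + K : ℝ) - y| ≤ |(t₀ + K : ℝ) - τ| + |τ - σ τ| + |(y : ℝ) - σ τ| := by
      have h1 := abs_sub_le (t₀ + K : ℝ) τ y
      have h2 := abs_sub_le τ (σ τ) y
      rw [abs_sub_comm (σ τ) (y : ℝ)] at h2
      linarith
    have hτy : |τ - y| ≤ |τ - σ τ| + |(y : ℝ) - σ τ| := by
      have h2 := abs_sub_le τ (σ τ) y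
      rwa [abs_sub_comm (σ τ) (y : ℝ)] at h2
    have hTK : 2 * G * c ≤ e * |(t₀ + K : ℝ) - y| := by
      rw [hT]
      rw [div_le_iff₀ he0] at hK2
      linarith
    rw [abs_sub_comm (σ τ) (y : ℝ)] at hg1
    have hA0 := abs_nonneg ((t₀ + K : ℝ) - τ)
    have hT0' : 0 < |(t₀ + K : ℝ) - y| := abs_pos.2 hT0.ne'
    generalize |(t₀ + K : ℝ) - τ| = A at *
    generalize |(y : ℝ) - σ τ| = z at *
    generalize |τ - σ τ| = g at *
    generalize |(t₀ + K : ℝ) - y| = T at *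
    have hTg : 0 < T * g := mul_pos hT0' hg
    refine le_trans (mul_le_mul_of_nonneg_right (by linarith : c - ε ≤ c - 2 * e) hTg.le) ?_
    -- If `z` is at least almost `T`, the bound for `t₀` carries over. Otherwise `σ τ` is far from
    -- `t₀ + K`, and so is `τ`, since gaps are at most `G`.
    rcases le_or_gt ((c - e) * T) (c * z) with hz | hz
    · have h1 : (c - e) * g * (c * z) ≤ 2 * A * (c * z) := by gcongr
      have h2 : (c - e) * g * ((c - e) * T) ≤ (c - e) * g * (c * z) := by
        apply mul_le_mul_of_nonneg_left hz
        exact mul_nonneg (by linarith) hg.le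
      have h3 : c * ((c - 2 * e) * (T * g)) ≤ c * (2 * (A * z)) := by
        have : 0 ≤ e ^ 2 * (T * g) := by positivity
        linarith
      exact le_of_mul_le_mul_left h3 hc
    · have h1 : e * T ≤ c * (T - z) := by linarith
      have h2 : e * T ≤ 2 * (c * A) := by
        have : c * (T - z) ≤ c * (A + g) := by gcongr; linarith
        have : c * g ≤ c * G := by gcongr
        linarith
      -- A pair too close to the pole relative to its gap `g` would have an image of gap at least
      -- the threshold.
      have h3 : M * g ≤ z := by
        by_contra hlt'
        push Not at hlt'
        have h4 : |τ - y| ≤ (M + 1) * g := by linarith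
        have h5 : |τ - y| * z ≤ (M + 1) * g * (M * g) := by gcongr
        have h6 : g ≤ |moebius v τ - moebius v (σ τ)| * (q ^ 2 * ((M + 1) * g * (M * g))) :=
          hg1.symm.le.trans
            (mul_le_mul_of_nonneg_left (mul_le_mul_of_nonneg_left h5 hq2.le) hdpos)
        have h7 : g * 1 ≤ g * (|moebius v τ - moebius v (σ τ)| * (q ^ 2 * ((M + 1) * M * g))) := by
          linarith
        have h8 := le_of_mul_le_mul_left h7 hg
        have h9 : |moebius v τ - moebius v (σ τ)| * (q ^ 2 * ((M + 1) * M * g)) ≤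
            |moebius v τ - moebius v (σ τ)| * (q ^ 2 * ((M + 1) * M * G)) := by gcongr
        rw [lt_div_iff₀ (by positivity)] at hβδ
        linarith
      rw [hM, div_mul_eq_mul_div, div_le_iff₀ he0] at h3
      have h4 : e * T * (c ^ 2 * g) ≤ 2 * (c * A) * (z * e) := by gcongr
      have h5 : (c * e) * (c * (T * g)) ≤ (c * e) * (2 * (A * z)) := by linarith
      have h6 := le_of_mul_le_mul_left h5 (by positivity)
      have : 0 ≤ e * (T * g) := by positivity
      linarith
  · obtain ⟨hβK, hσK⟩ := H.add_int hβ₀ K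
    have hc1 := hcross _ hβK
    have hg1 := hgap _ hβK
    refine ⟨moebius v (β₀ + (K : ℤ)), H.moebius_mem v _ hβK, ?_⟩
    have hd := H.gap_pos (H.moebius_mem v _ hβK)
    rw [H.conj_moebius v _ hβK] at hd ⊢
    rw [hσK] at hc1 hg1 hd ⊢
    rw [hr]
    generalize |moebius v (β₀ + (K : ℤ)) - moebius v (σ β₀ + (K : ℤ))| = d at *
    generalize |moebius v (t₀ + K) - moebius v (β₀ + (K : ℤ))| = m at *
    have ex : |β₀ + (K : ℤ) - (σ β₀ + (K : ℤ))| = |β₀ - σ β₀| := by congr 1; ring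
    have ex2 : |(t₀ + K : ℝ) - (β₀ + (K : ℤ))| = |(t₀ : ℝ) - β₀| := by
      congr 1; push_cast; ring
    rw [ex] at hc1 hg1
    rw [ex2] at hc1
    push_cast at hc1 hg1
    have hs0 : 0 < |β₀ - σ β₀| / (q ^ 2 * ρ) := by positivity
    constructor
    · have h1 : 1 ≤ |β₀ + K - y| := by
        rw [le_abs]; left; linarith
      have h2 : 2 * |β₀ - σ β₀| / (q ^ 2 * ρ) ≤ |σ β₀ + K - y| := by
        rw [le_abs]; left; linarith
      rw [div_le_iff₀ (by positivity)] at h2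
      by_contra hcon
      push Not at hcon
      have h3 : ρ * (q ^ 2 * (1 * |σ β₀ + K - y|)) ≤
          d * (q ^ 2 * (|β₀ + K - y| * |σ β₀ + K - y|)) := by gcongr
      linarith
    · have hz : |(|(y : ℝ) - (σ β₀ + K)|) - (|(t₀ + K : ℝ) - y|)| ≤ |σ β₀ - t₀| := by
        rw [abs_sub_comm (t₀ + K : ℝ)]
        refine (abs_abs_sub_abs_le _ _).trans (le_of_eq ?_)
        rw [← abs_neg]; congr 1; ring
      rw [← hT, div_le_iff₀ (by positivity)] at hK3
      have hT0' : 0 < |(t₀ + K : ℝ) - y| := abs_pos.2 hT0.ne'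
      generalize |(y : ℝ) - (σ β₀ + K)| = z at *
      generalize |(t₀ + K : ℝ) - y| = T at *
      have hμ0 := abs_nonneg ((t₀ : ℝ) - β₀)
      generalize |(t₀ : ℝ) - β₀| = μ at *
      generalize |β₀ - σ β₀| = g at *
      have hTg : 0 < T * g := mul_pos hT0' hg₀
      refine lt_of_mul_lt_mul_right ?_ hTg.le
      rw [← abs_of_pos hTg, ← abs_mul, abs_of_pos hTg]
      have e1 : (2 * m - c * d) * (T * g) = d * ((2 * μ - c * g) * T + 2 * μ * (z - T)) := by
        linear_combination 2 * hc1
      rw [e1, abs_mul, abs_of_pos hd]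
      have h1 : |(2 * μ - c * g) * T + 2 * μ * (z - T)| < 2 * e * (T * g) := by
        refine (abs_add_le _ _).trans_lt ?_
        rw [abs_mul, abs_mul, abs_of_pos hT0', abs_of_nonneg (by linarith : 0 ≤ 2 * μ)]
        have h2 : |2 * μ - c * g| * T < e * g * T := mul_lt_mul_of_pos_right hβt hT0'
        have h3 : 2 * μ * |z - T| ≤ 2 * μ * |σ β₀ - t₀| := by gcongr
        linarith
      calc d * |(2 * μ - c * g) * T + 2 * μ * (z - T)| < d * (2 * e * (T * g)) := by gcongr
        _ ≤ d * (ε * (T * g)) := by gcongr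
        _ = _ := by ring

end OrbitSystem

/-! ### Passage to a real limit with the exact constant -/

namespace OrbitSystem

variable {w : ℝ} {S : Set ℝ} {σ : ℝ → ℝ}

theorem exists_real_approx_const (H : OrbitSystem w S σ) {c c₀ : ℝ} (hc : 0 ≤ c) (hcc : c ≤ c₀)
    (hc₀ : 0 < c₀) (hcw : c₀ * (10 ^ 7 * w ^ 5) ≤ 1) :
    ∃ ξ : ℝ, (∀ ε > 0, ∃ δ > 0, ∀ β ∈ S, |β - σ β| < δ → (c - ε) * |β - σ β| ≤ 2 * |ξ - β|) ∧
      ∀ ε > 0, ∃ β ∈ S, |β - σ β| < ε ∧ |2 * |ξ - β| - (c * |β - σ β|)| < ε * |β - σ β| := by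
  let e : ℕ → ℝ := fun k => 1 / ((k : ℝ) + 1)
  have he0 : ∀ k, 0 < e k := fun k => Nat.one_div_pos_of_nat
  have helim : Tendsto e atTop (𝓝 0) := tendsto_one_div_add_atTop_nhds_zero_nat
  -- The cut-off keeps the constants positive when `c = 0`; they still tend to `c`.
  let cc : ℕ → ℝ := fun k => max c (c₀ * e k)
  have hcc0 : ∀ k, 0 < cc k := fun k => lt_max_of_lt_right (mul_pos hc₀ (he0 k))
  have hccw : ∀ k, cc k * (10 ^ 7 * w ^ 5) ≤ 1 := by
    intro k
    have hw := H.pos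
    have : cc k ≤ c₀ := by
      apply max_le hcc
      apply mul_le_of_le_one_right hc₀.le
      simp only [e]
      rw [div_le_one (by positivity)]
      have : (0 : ℝ) ≤ k := k.cast_nonneg
      linarith
    refine le_trans ?_ hcw
    gcongr
  -- A state `(r, Δ, ρ)` holds a rational, the gap size below which its successor obeys the lower
  -- bound, and the allowed displacement. The next `ρ` is small relative both to the next `Δ` and to
  -- the gap of the witness `β`, so later moves spoil neither estimate.
  obtain ⟨u, hu⟩ := exists_seq_of_step (A := ℚ × ℝ × ℝ)
    (fun k s => 0 < s.2.1 ∧ 0 < s.2.2 ∧ ∀ ρ > 0, ∃ r : ℚ, |(r : ℝ) - s.1| < ρ ∧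
      (∀ β ∈ S, |β - σ β| < s.2.1 → (cc k - e k) * |β - σ β| ≤ 2 * |r - β|) ∧
      ∃ β ∈ S, |β - σ β| < ρ ∧ |2 * |r - β| - (cc k * |β - σ β|)| < e k * |β - σ β|)
    (fun k s s' => s'.2.1 ≤ s.2.1 / 2 ∧ s'.2.2 ≤ s.2.2 / 2 ∧ |(s'.1 : ℝ) - s.1| < s.2.2 ∧
      (∀ β ∈ S, |β - σ β| < s.2.1 → (cc k - e k) * |β - σ β| ≤ 2 * |s'.1 - β|) ∧
      s'.2.2 ≤ e k * s'.2.1 ∧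
      ∃ β ∈ S, |β - σ β| < s.2.2 ∧ |2 * |s'.1 - β| - (cc k * |β - σ β|)| < e k * |β - σ β| ∧
        s'.2.2 ≤ e k * |β - σ β|)
    (by
      obtain ⟨δ, hδ, h⟩ := H.exists_rat_near (hcc0 0) (hccw 0) (he0 0) 0
      exact ⟨(0, δ, 1), hδ, one_pos, h⟩)
    (by
      rintro k ⟨r, Δ, ρ⟩ ⟨hΔ, hρ, h⟩
      obtain ⟨r', hr', hlow, β, hβ, hβρ, hβc⟩ := h ρ hρ
      obtain ⟨δ, hδ, h'⟩ := H.exists_rat_near (hcc0 (k + 1)) (hccw (k + 1)) (he0 (k + 1)) r'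
      have hg := H.gap_pos hβ
      have hΔ' : 0 < min δ (Δ / 2) := lt_min hδ (half_pos hΔ)
      have h1 := mul_pos (he0 k) hΔ'
      have h2 := mul_pos (he0 k) hg
      refine ⟨(r', min δ (Δ / 2),
        min (ρ / 2) (min (e k * min δ (Δ / 2)) (e k * |β - σ β|))),
        ⟨hΔ', lt_min (half_pos hρ) (lt_min h1 h2), ?_⟩, min_le_right _ _, min_le_left _ _, hr', hlow,
        (min_le_right _ _).trans (min_le_left _ _), β, hβ, hβρ, hβc,
        (min_le_right _ _).trans (min_le_right _ _)⟩
      intro ρ' hρ'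
      obtain ⟨r'', h1, h2, h3⟩ := h' ρ' hρ'
      exact ⟨r'', h1, fun β hβ hlt => h2 β hβ (hlt.trans_le (min_le_left _ _)), h3⟩)
  let r : ℕ → ℝ := fun k => (u k).1
  let Δ : ℕ → ℝ := fun k => (u k).2.1
  let ρ : ℕ → ℝ := fun k => (u k).2.2
  have hΔ0 : ∀ k, 0 < Δ k := fun k => (hu k).1.1
  have hρ0 : ∀ k, 0 < ρ k := fun k => (hu k).1.2.1
  have hΔs : ∀ k, Δ (k + 1) ≤ Δ k / 2 := fun k => (hu k).2.1
  have hρs : ∀ k, ρ (k + 1) ≤ ρ k / 2 := fun k => (hu k).2.2.1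
  have hr : ∀ k, |r (k + 1) - r k| < ρ k := fun k => (hu k).2.2.2.1
  have hlow : ∀ k, ∀ β ∈ S, |β - σ β| < Δ k → (cc k - e k) * |β - σ β| ≤ 2 * |r (k + 1) - β| :=
    fun k => (hu k).2.2.2.2.1
  have hρΔ : ∀ k, ρ (k + 1) ≤ e k * Δ (k + 1) := fun k => (hu k).2.2.2.2.2.1
  have hβ : ∀ k, ∃ β ∈ S, |β - σ β| < ρ k ∧
      |2 * |r (k + 1) - β| - (cc k * |β - σ β|)| < e k * |β - σ β| ∧
        ρ (k + 1) ≤ e k * |β - σ β| := fun k => (hu k).2.2.2.2.2.2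
  have halve : ∀ x : ℕ → ℝ, (∀ k, 0 < x k) → (∀ k, x (k + 1) ≤ x k / 2) →
      Tendsto x atTop (𝓝 0) := by
    intro x hx0 hxs
    have hle : ∀ k, x k ≤ x 0 * (1 / 2 : ℝ) ^ k := by
      intro k
      induction k with
      | zero => simp
      | succ k ih => rw [pow_succ]; have := hxs k; linarith
    have hlim : Tendsto (fun k => x 0 * (1 / 2 : ℝ) ^ k) atTop (𝓝 (x 0 * 0)) :=
      (tendsto_pow_atTop_nhds_zero_of_lt_one (by norm_num) (by norm_num)).const_mul _
    rw [mul_zero] at hlim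
    exact squeeze_zero (fun k => (hx0 k).le) hle hlim
  have hΔlim := halve Δ hΔ0 hΔs
  have hρlim := halve ρ hρ0 hρs
  have hmono : Monotone fun k => r k - 2 * ρ k := monotone_nat_of_le_succ fun k => by
    have h1 := abs_lt.1 (hr k)
    have h2 := hρs k
    linarith
  have hanti : Antitone fun k => r k + 2 * ρ k := antitone_nat_of_succ_le fun k => by
    have h1 := abs_lt.1 (hr k)
    have h2 := hρs k
    linarith
  have hmem := hmono.ciSup_mem_iInter_Icc_of_antitone hanti
    (fun k => by have := hρ0 k; simp only; linarith)
  rw [Set.mem_iInter] at hmem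
  generalize (⨆ k, (r k - 2 * ρ k)) = ξ at hmem
  have hξ : ∀ k, |ξ - r k| ≤ 2 * ρ k := by
    intro k
    have := hmem k
    rw [abs_le]
    exact ⟨by linarith [this.1], by linarith [this.2]⟩
  refine ⟨ξ, ?_, ?_⟩
  · intro ε hε
    obtain ⟨k₀, hk₀⟩ := (helim.eventually
      (gt_mem_nhds (by positivity : (0 : ℝ) < ε / 5))).exists_forall_of_atTop
    refine ⟨Δ k₀, hΔ0 k₀, fun β hβS hβΔ => ?_⟩
    have hg := H.gap_pos hβS
    classical
    -- The gap falls into some range from `Δ (k + 1)` to `Δ k`. There `r (k + 1)` gives the bound,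
    -- and `ξ` is within `2 * e k` gaps of it.
    have hex : ∃ k, Δ (k + 1) ≤ |β - σ β| ∧ k₀ ≤ k := by
      have := ((hΔlim.comp (tendsto_add_atTop_nat 1)).eventually (gt_mem_nhds hg)).and
        (eventually_ge_atTop k₀)
      obtain ⟨k, h1, h2⟩ := this.exists
      exact ⟨k, h1.le, h2⟩
    obtain ⟨k, ⟨h1, h2⟩, h3⟩ : ∃ k, (Δ (k + 1) ≤ |β - σ β| ∧ k₀ ≤ k) ∧ |β - σ β| < Δ k := by
      refine ⟨Nat.find hex, Nat.find_spec hex, ?_⟩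
      rcases Nat.eq_or_lt_of_le (Nat.find_spec hex).2 with h | h
      · rwa [← h]
      · obtain ⟨m, hm⟩ := Nat.exists_eq_succ_of_ne_zero
          (Nat.ne_of_gt (lt_of_le_of_lt (Nat.zero_le k₀) h))
        by_contra hcon
        push Not at hcon
        have hlt : m < Nat.find hex := by omega
        apply Nat.find_min hex hlt
        rw [hm] at hcon h
        exact ⟨hcon, by omega⟩
    have h4 := hlow k β hβS h3
    have h5 := hξ (k + 1)
    have h6 := hρΔ k
    have h7 : e k * Δ (k + 1) ≤ e k * |β - σ β| := by
      have := he0 k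
      gcongr
    have h8 : |r (k + 1) - β| ≤ |ξ - r (k + 1)| + |ξ - β| := by
      have := abs_sub_le (r (k + 1)) ξ β
      rwa [abs_sub_comm (r (k + 1)) ξ] at this
    have h9 : e k * |β - σ β| ≤ ε / 5 * |β - σ β| := by
      have := (hk₀ k h2).le
      gcongr
    have h10 : c * |β - σ β| ≤ cc k * |β - σ β| := by
      have : c ≤ cc k := le_max_left _ _
      gcongr
    linarith
  · intro ε hε
    have hcclim : Tendsto cc atTop (𝓝 c) := by
      have h1 : Tendsto (fun k => c₀ * e k) atTop (𝓝 (c₀ * 0)) := helim.const_mul _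
      have h2 := (tendsto_const_nhds (x := c)).max h1
      rwa [mul_zero, max_eq_left hc] at h2
    obtain ⟨k, h1, h2, h3⟩ := ((helim.eventually (gt_mem_nhds (by positivity : (0 : ℝ) < ε / 10))).and
      ((hρlim.eventually (gt_mem_nhds hε)).and
      (hcclim.eventually (gt_mem_nhds (by linarith : c < c + ε / 10))))).exists
    obtain ⟨β, hβS, h4, h5, h6⟩ := hβ k
    refine ⟨β, hβS, h4.trans h2, ?_⟩
    have hg := H.gap_pos hβS
    have h7 := hξ (k + 1)
    have h8 : |(|ξ - β|) - (|r (k + 1) - β|)| ≤ |ξ - r (k + 1)| := by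
      refine (abs_abs_sub_abs_le _ _).trans (le_of_eq ?_)
      congr 1; ring
    have h9 : e k * |β - σ β| ≤ ε / 10 * |β - σ β| := by gcongr
    have h10 : c * |β - σ β| ≤ cc k * |β - σ β| := by
      have : c ≤ cc k := le_max_left _ _
      gcongr
    have h11 : cc k * |β - σ β| ≤ (c + ε / 10) * |β - σ β| := by gcongr
    rw [abs_le] at h8
    rw [abs_lt] at h5 ⊢
    have : 0 < ε * |β - σ β| := mul_pos hε hg
    constructor <;> linarith

variable {c ξ : ℝ}

/-- For rational `ξ`, both roots `β`, `σ β` would be within two gaps of it, and `gap_le_of_rat`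
would keep the gaps away from zero. -/
theorem irrational_of_approx (H : OrbitSystem w S σ) (hc : c ≤ 1)
    (h : ∀ ε > 0, ∃ β ∈ S, |β - σ β| < ε ∧ |2 * |ξ - β| - (c * |β - σ β|)| < ε * |β - σ β|) :
    Irrational ξ := by
  rintro ⟨z, rfl⟩
  have hw := H.pos
  have hden : (0 : ℝ) < z.den := by exact_mod_cast z.den_pos
  obtain ⟨β, hβ, h1, h2⟩ := h (min 1 (1 / (2 * (w * z.den ^ 2)))) (by positivity)
  rw [lt_min_iff] at h1
  have hg := H.gap_pos hβ
  have h3 : |z - β| ≤ |β - σ β| := by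
    have h4 := (abs_lt.1 h2).2
    have h5 : min 1 (1 / (2 * (w * z.den ^ 2))) * |β - σ β| ≤ 1 * |β - σ β| := by
      gcongr; exact min_le_left _ _
    have h6 : c * |β - σ β| ≤ 1 * |β - σ β| := by gcongr
    linarith
  have h4 : |z - σ β| ≤ 2 * |β - σ β| := by
    have := abs_sub_le (z : ℝ) β (σ β)
    linarith
  have h5 := H.gap_le_of_rat hβ z
  have h6 : |β - σ β| * 1 ≤ |β - σ β| * (|β - σ β| * (2 * (w * z.den ^ 2))) := by
    calc |β - σ β| * 1 ≤ w * z.den ^ 2 * (|z - β| * |z - σ β|) := by rw [mul_one]; exact h5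
      _ ≤ w * z.den ^ 2 * (|β - σ β| * (2 * |β - σ β|)) := by gcongr
      _ = _ := by ring
  have h7 := le_of_mul_le_mul_left h6 hg
  have h8 := h1.2
  rw [lt_div_iff₀ (by positivity)] at h8
  linarith

/-- If `ξ` were in the orbit, an element of smaller gap would lie within a tenth of its gap over `w
^ 2` from `ξ`, violating separation. -/
theorem not_mem_of_approx (H : OrbitSystem w S σ) (hc : c * (10 * w ^ 2) ≤ 1)
    (h : ∀ ε > 0, ∃ β ∈ S, |β - σ β| < ε ∧ |2 * |ξ - β| - (c * |β - σ β|)| < ε * |β - σ β|) :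
    ξ ∉ S := by
  intro hξ
  have hw2 : 1 ≤ w ^ 2 := one_le_pow₀ H.one_le
  have hgξ := H.gap_pos hξ
  obtain ⟨β, hβ, h1, h2⟩ := h (min |ξ - σ ξ| (1 / (10 * w ^ 2))) (by positivity)
  rw [lt_min_iff] at h1
  have hg := H.gap_pos hβ
  have hne : ξ ≠ β := by
    rintro rfl
    exact lt_irrefl _ h1.1
  have hsep := H.separation hξ hβ hne
  have h3 : |ξ - β| * (10 * w ^ 2) ≤ |β - σ β| := by
    have h4 := (abs_lt.1 h2).2
    have h5 : min |ξ - σ ξ| (1 / (10 * w ^ 2)) * |β - σ β| ≤ 1 / (10 * w ^ 2) * |β - σ β| := by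
      gcongr; exact min_le_right _ _
    have h6 : c ≤ 1 / (10 * w ^ 2) := by rwa [le_div_iff₀ (by positivity)]
    have h7 : c * |β - σ β| ≤ 1 / (10 * w ^ 2) * |β - σ β| := by gcongr
    have h8 : |ξ - β| ≤ 1 / (10 * w ^ 2) * |β - σ β| := by linarith
    rwa [div_mul_eq_mul_div, one_mul, le_div_iff₀ (by positivity)] at h8
  have h4 : |ξ - β| ≤ |ξ - σ ξ| := by nlinarith [abs_nonneg (ξ - β)]
  have h5 : |ξ - β| * (10 * w ^ 2) * (|ξ - β| + |ξ - σ ξ| + |β - σ β|) ≤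
      |β - σ β| * (3 * |ξ - σ ξ|) := by
    gcongr
    linarith [h1.1]
  have := mul_pos hgξ hg
  linarith

theorem liminf_eq (H : OrbitSystem w S σ)
    (h1 : ∀ ε > 0, ∃ δ > 0, ∀ β ∈ S, |β - σ β| < δ → (c - ε) * |β - σ β| ≤ 2 * |ξ - β|)
    (h2 : ∀ ε > 0, ∃ β ∈ S, |β - σ β| < ε ∧ |2 * |ξ - β| - (c * |β - σ β|)| < ε * |β - σ β|) :
    liminf (fun β : ℝ => ((2 * |ξ - β| / |β - σ β| : ℝ) : EReal))
      (comap (fun β : ℝ => |β - σ β|) (𝓝 0) ⊓ 𝓟 S) = (c : EReal) := by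
  have hbasis : (comap (fun β : ℝ => |β - σ β|) (𝓝 0) ⊓ 𝓟 S).HasBasis (fun ε : ℝ => 0 < ε)
      (fun ε => (fun β : ℝ => |β - σ β|) ⁻¹' Metric.ball 0 ε ∩ S) :=
    (Metric.nhds_basis_ball.comap _).inf_principal S
  have hball : ∀ β ε, β ∈ (fun β : ℝ => |β - σ β|) ⁻¹' Metric.ball 0 ε ↔ |β - σ β| < ε := by
    intro β ε
    rw [Set.mem_preimage, Metric.mem_ball, Real.dist_eq, sub_zero, abs_abs]
  apply le_antisymm
  · rw [← EReal.le_of_forall_lt_iff_le]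
    intro z hz
    rw [EReal.coe_lt_coe_iff] at hz
    apply liminf_le_of_frequently_le'
    rw [hbasis.frequently_iff]
    intro ε hε
    obtain ⟨β, hβ, h3, h4⟩ := h2 (min ε (z - c)) (lt_min hε (sub_pos.2 hz))
    rw [lt_min_iff] at h3
    have hg := H.gap_pos hβ
    refine ⟨β, ⟨(hball _ _).2 h3.1, hβ⟩, ?_⟩
    rw [EReal.coe_le_coe_iff, div_le_iff₀ hg]
    have h5 := (abs_lt.1 h4).2
    have h6 : min ε (z - c) * |β - σ β| ≤ (z - c) * |β - σ β| := by
      gcongr; exact min_le_right _ _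
    linarith
  · rw [← EReal.ge_of_forall_gt_iff_ge]
    intro z hz
    rw [EReal.coe_lt_coe_iff] at hz
    apply le_liminf_of_le
    · isBoundedDefault
    rw [hbasis.eventually_iff]
    obtain ⟨δ, hδ, h3⟩ := h1 (c - z) (sub_pos.2 hz)
    refine ⟨δ, hδ, fun β hβ => ?_⟩
    have h4 := h3 β hβ.2 ((hball _ _).1 hβ.1)
    rw [EReal.coe_le_coe_iff, le_div_iff₀ (H.gap_pos hβ.2)]
    linarith

end OrbitSystem

theorem mem_Sp_of_orbitSystem {w α : ℝ} (H : OrbitSystem w (Theta α) galConj) {c c₀ : ℝ}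
    (hc : 0 ≤ c) (hcc : c ≤ c₀) (hc₀ : 0 < c₀) (hcw : c₀ * (10 ^ 7 * w ^ 5) ≤ 1) : c ∈ Sp α := by
  obtain ⟨ξ, h1, h2⟩ := H.exists_real_approx_const hc hcc hc₀ hcw
  have hw := H.one_le
  have hw5 : 1 ≤ w ^ 5 := one_le_pow₀ hw
  have hw25 : w ^ 2 ≤ w ^ 5 := pow_le_pow_right₀ hw (by norm_num)
  have hc2 : c * (10 * w ^ 2) ≤ 1 := by
    refine le_trans ?_ hcw
    gcongr
    norm_num
  have hc1 : c ≤ 1 := by nlinarith [one_le_pow₀ hw (n := 2)]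
  exact ⟨ξ, H.irrational_of_approx hc1 h2, H.not_mem_of_approx hc2 h2, H.liminf_eq h1 h2⟩

/-! ### Galois conjugation and the orbit system of a quadratic number -/

theorem IsRealQuadratic.isIntegral {x : ℝ} (hx : IsRealQuadratic x) : IsIntegral ℚ x := by
  have h2 : (minpoly ℚ x).natDegree = 2 := hx
  by_contra h
  rw [minpoly.eq_zero h] at h2
  simp at h2

theorem IsRealQuadratic.irrational {x : ℝ} (hx : IsRealQuadratic x) : Irrational x := by
  have h := (minpoly.two_le_natDegree_iff hx.isIntegral).1 (le_of_eq (Eq.symm hx))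
  rintro ⟨q, hq⟩
  exact h ⟨q, by simpa using hq⟩

theorem galConj_eq {x y : ℝ} (hx : Irrational x) {s p : ℚ} (hs : x + y = s) (hp : x * y = p) :
    galConj x = y := by
  open Polynomial in
  have hdeg : (X ^ 2 - C s * X + C p : ℚ[X]).natDegree = 2 := by compute_degree!
  have hmon : (Polynomial.X ^ 2 - Polynomial.C s * Polynomial.X + Polynomial.C p :
      Polynomial ℚ).Monic := by monicity!
  have hroot : Polynomial.aeval x (Polynomial.X ^ 2 - Polynomial.C s * Polynomial.X +
      Polynomial.C p : Polynomial ℚ) = 0 := by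
    simp only [map_add, map_sub, map_mul, map_pow, Polynomial.aeval_X, Polynomial.aeval_C,
      eq_ratCast]
    rw [← hs, ← hp]; ring
  have hint : IsIntegral ℚ x := ⟨_, hmon, hroot⟩
  have h2 : 2 ≤ (minpoly ℚ x).natDegree := by
    rw [minpoly.two_le_natDegree_iff hint]
    rintro ⟨q, hq⟩
    exact hx ⟨q, by simpa using hq⟩
  have heq := Polynomial.eq_of_monic_of_dvd_of_natDegree_le (minpoly.monic hint) hmon
    (minpoly.dvd ℚ x hroot) (by rw [hdeg]; exact h2)
  have hcoeff : (minpoly ℚ x).coeff 1 = -s := by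
    rw [← heq]
    simp [Polynomial.coeff_C]
  rw [galConj, hcoeff]
  push_cast
  linarith

theorem IsRealQuadratic.add_mul_rat {x : ℝ} (hx : IsRealQuadratic x) :
    ∃ s p : ℚ, x + galConj x = s ∧ x * galConj x = p := by
  have h2 : (minpoly ℚ x).natDegree = 2 := hx
  have hmon := minpoly.monic hx.isIntegral
  have hc2 : (minpoly ℚ x).coeff 2 = 1 := by
    have := hmon.coeff_natDegree
    rwa [h2] at this
  have hx0 := minpoly.aeval ℚ x
  rw [Polynomial.aeval_eq_sum_range, h2] at hx0
  simp only [Finset.sum_range_succ, Finset.sum_range_zero, Algebra.smul_def, hc2, eq_ratCast]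
    at hx0
  refine ⟨-(minpoly ℚ x).coeff 1, (minpoly ℚ x).coeff 0, ?_, ?_⟩
  · rw [galConj]; push_cast; ring
  · rw [galConj]
    push_cast at hx0
    linear_combination -hx0

namespace ConjPair

variable {w x y : ℝ}

theorem rat (h : ConjPair w x y) (hw : 0 < w) : ∃ s p : ℚ, x + y = s ∧ x * y = p := by
  obtain ⟨a, b, c, h1, h2, h3⟩ := h
  have ha : (a : ℝ) ≠ 0 := by rintro h; rw [h] at h1; linarith
  refine ⟨b / a, c / a, ?_, ?_⟩
  · push_cast; rw [← h2]; field_simp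
  · push_cast; rw [← h3]; field_simp

theorem galConj_eq (h : ConjPair w x y) (hw : 0 < w) (hx : Irrational x) : galConj x = y := by
  obtain ⟨s, p, hs, hp⟩ := h.rat hw
  exact QuadLagrange.galConj_eq hx hs hp

theorem one_le (h : ConjPair w x y) (hw : 0 < w) : 1 ≤ w := by
  obtain ⟨a, b, c, h1, h2, h3⟩ := h
  have e : ((b ^ 2 - 4 * a * c : ℤ) : ℝ) = w ^ 2 := by
    push_cast; rw [← h1, ← h2]
    linear_combination 4 * (a : ℝ) * h3
  have h4 := one_le_abs_intCast (m := b ^ 2 - 4 * a * c) (by rw [e]; positivity)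
  rw [e, abs_of_pos (by positivity)] at h4
  nlinarith

theorem add_int (h : ConjPair w x y) (n : ℤ) : ConjPair w (n + x) (n + y) := by
  obtain ⟨a, b, c, h1, h2, h3⟩ := h
  refine ⟨a, 2 * a * n + b, a * n ^ 2 + b * n + c, ?_, ?_, ?_⟩
  · linear_combination h1
  · push_cast; linear_combination h2
  · push_cast; linear_combination h3 + n * h2

theorem inv (h : ConjPair w x y) (hx : x ≠ 0) (hy : y ≠ 0) : ConjPair w x⁻¹ y⁻¹ := by
  obtain ⟨a, b, c, h1, h2, h3⟩ := h
  refine ⟨-c, -b, -a, ?_, ?_, ?_⟩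
  · push_cast; rw [← h3, ← h1]; field_simp; ring
  · push_cast; rw [← h3, ← h2]; field_simp; ring
  · push_cast; rw [← h3]; field_simp

theorem inv_sub (h : ConjPair w x y) (n : ℤ) (hx : x - n ≠ 0) (hy : y - n ≠ 0) :
    ConjPair w (x - n)⁻¹ (y - n)⁻¹ := by
  have h' := h.add_int (-n)
  push_cast at h'
  rw [neg_add_eq_sub, neg_add_eq_sub] at h'
  exact h'.inv hx hy

theorem irrational_right (h : ConjPair w x y) (hw : 0 < w) (hx : Irrational x) :
    Irrational y := by
  obtain ⟨s, p, hs, -⟩ := h.rat hw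
  have : y = s - x := by linarith
  rw [this]
  exact hx.ratCast_sub s

end ConjPair

/-- Conjugation commutes with the action because `ConjPair` is preserved by it and determines the
conjugate. -/
theorem orbitSystem_Theta {w α : ℝ} (hα : Irrational α) (hw : 0 < w)
    (h : ConjPair w α (galConj α)) : OrbitSystem w (Theta α) galConj := by
  have hα' := h.irrational_right hw hα
  have conj1 : ∀ g, galConj (moebius g α) = moebius g (galConj α) := fun g =>
    (h.moebius g hα hα').galConj_eq hw (irrational_moebius g hα)
  have conj2 : ∀ g, galConj (moebius g (galConj α)) = moebius g α := fun g =>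
    (h.symm.moebius g hα' hα).galConj_eq hw (irrational_moebius g hα')
  refine ⟨h.one_le hw, ⟨moebius 1 α, 1, Or.inl rfl⟩, ?_, ?_, ?_, ?_, ?_, ?_⟩
  · rintro β ⟨g, rfl | rfl⟩
    · exact irrational_moebius g hα
    · exact irrational_moebius g hα'
  · rintro β ⟨g, rfl | rfl⟩
    · exact ⟨g, Or.inr (conj1 g)⟩
    · exact ⟨g, Or.inl (conj2 g)⟩
  · rintro β ⟨g, rfl | rfl⟩
    · rw [conj1, conj2]
    · rw [conj2, conj1]
  · rintro β ⟨g, rfl | rfl⟩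
    · rw [conj1]; exact h.moebius g hα hα'
    · rw [conj2]; exact h.symm.moebius g hα' hα
  · rintro k β ⟨g, rfl | rfl⟩
    · exact ⟨k * g, Or.inl (moebius_mul k g hα).symm⟩
    · exact ⟨k * g, Or.inr (moebius_mul k g hα').symm⟩
  · rintro k β ⟨g, rfl | rfl⟩
    · rw [← moebius_mul k g hα, conj1, conj1, moebius_mul k g hα']
    · rw [← moebius_mul k g hα', conj2, conj2, moebius_mul k g hα]

theorem IsRealQuadratic.exists_conjPair {x : ℝ} (hx : IsRealQuadratic x) :
    ∃ w > 0, ConjPair w x (galConj x) := by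
  obtain ⟨s, p, hs, hp⟩ := hx.add_mul_rat
  have hne : x - galConj x ≠ 0 := sub_ne_zero.2 (galConj_spec hx).1.symm
  have hsd : (s : ℝ) * s.den = s.num := by exact_mod_cast Rat.mul_den_eq_num s
  have hpd : (p : ℝ) * p.den = p.num := by exact_mod_cast Rat.mul_den_eq_num p
  have hpos : (0 : ℝ) < s.den * p.den := by
    exact_mod_cast Nat.mul_pos s.den_pos p.den_pos
  rcases lt_or_gt_of_ne hne with h | h
  · refine ⟨s.den * p.den * -(x - galConj x), mul_pos hpos (neg_pos.2 h), -(s.den * p.den),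
      -(s.num * p.den), -(p.num * s.den), ?_, ?_, ?_⟩
    · push_cast; ring
    · push_cast; rw [hs, ← hsd]; ring
    · push_cast; rw [hp, ← hpd]; ring
  · refine ⟨s.den * p.den * (x - galConj x), mul_pos hpos h, s.den * p.den,
      s.num * p.den, p.num * s.den, ?_, ?_, ?_⟩
    · push_cast; ring
    · push_cast; rw [hs, ← hsd]; ring
    · push_cast; rw [hp, ← hpd]; ring

/-! ### Continued fractions: periodicity and a bound for the discriminant -/

/-- A continued fraction expansion determines the number. -/
theorem eq_of_same_floors (x y : ℕ → ℝ) (a : ℕ → ℤ) (hx : ∀ k, x (k + 1) = (x k - a k)⁻¹)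
    (hy : ∀ k, y (k + 1) = (y k - a k)⁻¹) (hxa : ∀ k, 0 < x k - a k ∧ x k - a k < 1)
    (hya : ∀ k, 0 < y k - a k ∧ y k - a k < 1) : x 0 = y 0 := by
  -- With `θ k = z k - a k`, the product is `θ (k + 1) / (a (k + 1) + θ (k + 1))`, and `a (k + 1) ≥
  -- 1`. Two steps of both expansions thus contract differences by `1 / 4`.
  have contr : ∀ z : ℕ → ℝ, (∀ k, z (k + 1) = (z k - a k)⁻¹) →
      (∀ k, 0 < z k - a k ∧ z k - a k < 1) →
      ∀ k, (z k - a k) * (z (k + 1) - a (k + 1)) ≤ 1 / 2 := by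
    intro z hz hza k
    obtain ⟨h1, h2⟩ := hza k
    obtain ⟨h3, h4⟩ := hza (k + 1)
    have h5 : (z k - a k) * z (k + 1) = 1 := by rw [hz, mul_inv_cancel₀ h1.ne']
    have h6 : 1 < z (k + 1) := by rw [hz]; exact (one_lt_inv₀ h1).2 h2
    have h7 : (1 : ℝ) ≤ a (k + 1) := by
      have : (0 : ℝ) < a (k + 1) := by linarith
      exact_mod_cast (by exact_mod_cast this : 0 < a (k + 1))
    nlinarith
  have step : ∀ k, |x k - y k| ≤ |x (k + 1 + 1) - y (k + 1 + 1)| * (1 / 4) := by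
    have one : ∀ k, x k - y k =
        -((x (k + 1) - y (k + 1)) * ((x k - a k) * (y k - a k))) := by
      intro k
      have h1 := (hxa k).1.ne'
      have h2 := (hya k).1.ne'
      rw [hx, hy]
      field_simp
      ring
    intro k
    have e : x k - y k = (x (k + 1 + 1) - y (k + 1 + 1)) *
        (((x k - a k) * (x (k + 1) - a (k + 1))) * ((y k - a k) * (y (k + 1) - a (k + 1)))) := by
      rw [one k, one (k + 1)]; ring
    have p1 := mul_pos (hxa k).1 (hxa (k + 1)).1
    have p2 := mul_pos (hya k).1 (hya (k + 1)).1
    have c1 := contr x hx hxa k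
    have c2 := contr y hy hya k
    rw [e, abs_mul, abs_of_pos (mul_pos p1 p2)]
    gcongr
    calc _ ≤ (1 / 2 : ℝ) * (1 / 2) := by gcongr
      _ = 1 / 4 := by norm_num
  have bound : ∀ m k, |x k - y k| ≤ (1 / 4 : ℝ) ^ m := by
    intro m
    induction m with
    | zero =>
      intro k
      have h1 := hxa k
      have h2 := hya k
      rw [pow_zero, abs_le]
      constructor <;> linarith
    | succ m ih =>
      intro k
      rw [pow_succ]
      have := step k
      have := ih (k + 1 + 1)
      linarith
  have hlim : Tendsto (fun m : ℕ => (1 / 4 : ℝ) ^ m) atTop (𝓝 0) :=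
    tendsto_pow_atTop_nhds_zero_of_lt_one (by norm_num) (by norm_num)
  have h0 := ge_of_tendsto' hlim fun m => bound m 0
  exact sub_eq_zero.1 (abs_nonpos_iff.1 h0)

section CompleteQuotients

variable {x : ℝ}

theorem completeQuot_succ (x : ℝ) (k : ℕ) :
    completeQuot x (k + 1) = (completeQuot x k - partialQuot x k)⁻¹ := by
  unfold partialQuot completeQuot
  rw [Function.iterate_succ_apply', Int.fract]

theorem completeQuot_add (x : ℝ) (k m : ℕ) :
    completeQuot x (k + m) = completeQuot (completeQuot x k) m := by
  unfold completeQuot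
  rw [add_comm, Function.iterate_add_apply]

theorem irrational_completeQuot (hx : Irrational x) (k : ℕ) : Irrational (completeQuot x k) := by
  induction k with
  | zero => exact hx
  | succ k ih =>
    rw [completeQuot_succ]
    exact (ih.sub_intCast _).inv

theorem completeQuot_sub_pos (hx : Irrational x) (k : ℕ) :
    0 < completeQuot x k - partialQuot x k ∧ completeQuot x k - partialQuot x k < 1 := by
  have h1 := Int.floor_le (completeQuot x k)
  have h2 := Int.lt_floor_add_one (completeQuot x k)
  have h3 := (irrational_completeQuot hx k).ne_int (partialQuot x k)
  unfold partialQuot at *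
  constructor
  · rw [sub_pos]; exact lt_of_le_of_ne h1 h3.symm
  · linarith

theorem one_lt_completeQuot_succ (hx : Irrational x) (k : ℕ) : 1 < completeQuot x (k + 1) := by
  rw [completeQuot_succ]
  obtain ⟨h1, h2⟩ := completeQuot_sub_pos hx k
  exact (one_lt_inv₀ h1).2 h2

theorem one_le_partialQuot_succ (hx : Irrational x) (k : ℕ) : 1 ≤ partialQuot x (k + 1) := by
  unfold partialQuot
  rw [Int.le_floor]
  exact_mod_cast (one_lt_completeQuot_succ hx k).le

variable {w : ℝ}

theorem conjPair_completeQuot (hx : Irrational x) (hw : 0 < w) (h : ConjPair w x (galConj x))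
    (k : ℕ) : ConjPair w (completeQuot x k) (galConj (completeQuot x k)) ∧
      galConj (completeQuot x (k + 1)) = (galConj (completeQuot x k) - partialQuot x k)⁻¹ := by
  have step : ∀ k, ConjPair w (completeQuot x k) (galConj (completeQuot x k)) →
      ConjPair w (completeQuot x (k + 1)) (galConj (completeQuot x k) - partialQuot x k)⁻¹ := by
    intro k hk
    have hirr := irrational_completeQuot hx k
    rw [completeQuot_succ]
    exact hk.inv_sub _ (sub_ne_zero.2 (hirr.ne_int _))
      (sub_ne_zero.2 ((hk.irrational_right hw hirr).ne_int _))
  have all : ∀ k, ConjPair w (completeQuot x k) (galConj (completeQuot x k)) := by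
    intro k
    induction k with
    | zero => exact h
    | succ k ih =>
      have h1 := step k ih
      rwa [h1.galConj_eq hw (irrational_completeQuot hx _)]
  exact ⟨all k, (step k (all k)).galConj_eq hw (irrational_completeQuot hx _)⟩

/-- If the conjugates always had the same floors as the complete quotients, both expansions would
agree and `x` would equal its conjugate. Once the floors differ, a negative conjugate appears within
two steps, and negativity persists. -/
theorem eventually_conj_neg (hx : Irrational x) (hw : 0 < w) (h : ConjPair w x (galConj x)) :
    ∃ N, ∀ k, N ≤ k → galConj (completeQuot x (k + 1)) < 0 := by
  have hrec := fun k => (conjPair_completeQuot hx hw h k).2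
  have hirr : ∀ k, Irrational (galConj (completeQuot x k)) := fun k =>
    (conjPair_completeQuot hx hw h k).1.irrational_right hw (irrational_completeQuot hx k)
  have persist : ∀ N, galConj (completeQuot x (N + 1)) < 0 →
      ∀ k, N ≤ k → galConj (completeQuot x (k + 1)) < 0 := by
    intro N hN k hk
    induction k, hk using Nat.le_induction with
    | base => exact hN
    | succ k _ ih =>
      rw [hrec, inv_neg'']
      have : (1 : ℝ) ≤ partialQuot x (k + 1) := by exact_mod_cast one_le_partialQuot_succ hx k
      linarith
  by_cases hall : ∀ k, 0 < galConj (completeQuot x k) - partialQuot x k ∧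
      galConj (completeQuot x k) - partialQuot x k < 1
  · exfalso
    have := eq_of_same_floors (completeQuot x) (fun k => galConj (completeQuot x k))
      (partialQuot x) (completeQuot_succ x) hrec (completeQuot_sub_pos hx) hall
    obtain ⟨a, b, c, h1, -⟩ := h
    have h0 : x = galConj x := this
    rw [← h0, sub_self, mul_zero] at h1
    exact hw.ne h1
  · push Not at hall
    obtain ⟨k, hk⟩ := hall
    rcases lt_or_ge 0 (galConj (completeQuot x k) - partialQuot x k) with h1 | h1
    · refine ⟨k + 1, persist _ ?_⟩
      have h2 : galConj (completeQuot x (k + 1)) ≤ 1 := by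
        rw [hrec]; exact inv_le_one_of_one_le₀ (hk h1)
      have h3 : galConj (completeQuot x (k + 1)) ≠ 1 := (hirr _).ne_one
      have h4 : (1 : ℝ) ≤ partialQuot x (k + 1) := by exact_mod_cast one_le_partialQuot_succ hx k
      rw [hrec, inv_neg'']
      have := lt_of_le_of_ne h2 h3
      linarith
    · refine ⟨k, persist _ ?_⟩
      rw [hrec, inv_neg'']
      exact lt_of_le_of_ne h1 (sub_ne_zero.2 ((hirr k).ne_int _))

/-- Roots of opposite sign give `a c < 0`, so `b ^ 2 + 4 |a c| = w ^ 2` bounds the coefficients. -/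
theorem finite_reduced (hw : 0 < w) : {x : ℝ | ∃ y, 0 < x ∧ y < 0 ∧ ConjPair w x y}.Finite := by
  obtain ⟨n, hn⟩ := exists_nat_ge (w ^ 2)
  refine Set.Finite.subset
    (((Set.finite_Icc (-(n : ℤ)) n).prod (Set.finite_Icc (-(n : ℤ)) n)).image
      (fun p : ℤ × ℤ => (w + p.2) / (2 * p.1))) ?_
  rintro x ⟨y, hx, hy, a, b, c, h1, h2, h3⟩
  have ha : (a : ℝ) ≠ 0 := by rintro h; rw [h] at h1; linarith
  have hdisc : (b : ℝ) ^ 2 + 4 * (-(a * c)) = w ^ 2 := by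
    rw [← h1, ← h2]
    linear_combination 4 * (a : ℝ) * h3
  have hac : (a : ℝ) * c < 0 := by
    rw [← h3]
    have : 0 < (a : ℝ) ^ 2 := by positivity
    have : x * y < 0 := mul_neg_of_pos_of_neg hx hy
    nlinarith
  have hac' : a * c < 0 := by exact_mod_cast hac
  have hdisc' : b ^ 2 + 4 * (-(a * c)) ≤ n := by
    have : (b : ℝ) ^ 2 + 4 * (-(a * c)) ≤ n := hdisc.le.trans hn
    exact_mod_cast this
  have habs : |a| ≤ -(a * c) := by
    have hc : 1 ≤ |c| := Int.one_le_abs (by rintro rfl; simp at hac')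
    rw [← abs_of_neg hac', abs_mul]
    exact le_mul_of_one_le_right (abs_nonneg a) hc
  have hb : |b| ≤ b ^ 2 := by
    rw [← sq_abs]
    rcases (abs_nonneg b).eq_or_lt with h | h
    · rw [← h]; simp
    · nlinarith
  refine ⟨(a, b), ⟨abs_le.1 (by nlinarith [sq_nonneg b]), abs_le.1 (by linarith)⟩, ?_⟩
  simp only
  rw [← h1, ← h2]
  field_simp
  ring

/-- Lagrange's theorem: the continued fraction expansion of a quadratic irrational is eventually
periodic. -/
theorem exists_periodicFrom (hx : Irrational x) (hw : 0 < w) (h : ConjPair w x (galConj x)) :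
    ∃ s, 0 < s ∧ ∃ N, PeriodicFrom x N s := by
  obtain ⟨N, hN⟩ := eventually_conj_neg hx hw h
  have hmem : ∀ k, completeQuot x (N + k + 1) ∈
      {x : ℝ | ∃ y, 0 < x ∧ y < 0 ∧ ConjPair w x y} := fun k =>
    ⟨_, one_pos.trans (one_lt_completeQuot_succ hx _), hN _ (Nat.le_add_right _ _),
      (conjPair_completeQuot hx hw h _).1⟩
  have : Finite {x : ℝ | ∃ y, 0 < x ∧ y < 0 ∧ ConjPair w x y} := finite_reduced hw
  obtain ⟨i, j, hij, heq⟩ := Finite.exists_ne_map_eq_of_infinite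
    (fun k => (⟨_, hmem k⟩ : {x : ℝ | ∃ y, 0 < x ∧ y < 0 ∧ ConjPair w x y}))
  rw [Subtype.mk_eq_mk] at heq
  wlog hlt : i < j generalizing i j
  · exact this j i hij.symm heq.symm (by omega)
  refine ⟨j - i, by omega, N + i + 1, fun k hk => ?_⟩
  have e1 : k + (j - i) = N + j + 1 + (k - (N + i + 1)) := by omega
  have e2 : k = N + i + 1 + (k - (N + i + 1)) := by omega
  unfold partialQuot
  rw [e1]
  conv_rhs => rw [e2]
  rw [completeQuot_add, completeQuot_add x (N + i + 1), heq]

theorem completeQuot_eq_of_periodicFrom (hx : Irrational x) {N s : ℕ} (h : PeriodicFrom x N s) :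
    completeQuot x (N + s) = completeQuot x N := by
  refine eq_of_same_floors (fun k => completeQuot x (N + s + k)) (fun k => completeQuot x (N + k))
    (fun k => partialQuot x (N + k)) ?_ ?_ ?_ ?_
  · intro k
    have := completeQuot_succ x (N + s + k)
    rw [add_right_comm N s k, h _ (Nat.le_add_right _ _)] at this
    rw [add_right_comm N s k, ← this]
    congr 1; omega
  · intro k
    exact completeQuot_succ x (N + k)
  · intro k
    have := completeQuot_sub_pos hx (N + s + k)
    rwa [add_right_comm N s k, h _ (Nat.le_add_right _ _), ← add_right_comm N s k] at this
  · intro k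
    exact completeQuot_sub_pos hx (N + k)

/-- The matrix is the product of the blocks `(a k, 1; 1, 0)`; each factor multiplies the row sums by
at most `a k + 1 ≤ K`. -/
theorem exists_bounded_matrix (z : ℕ → ℝ) (a : ℕ → ℤ) (K : ℤ) (hz0 : ∀ k, 0 < z k)
    (hz : ∀ k, z k = a k + (z (k + 1))⁻¹) (s : ℕ) (ha : ∀ k < s, 1 ≤ a k ∧ a k + 1 ≤ K) :
    ∃ p q r t : ℤ, 0 ≤ p ∧ 0 ≤ q ∧ 0 ≤ r ∧ 0 ≤ t ∧ 1 ≤ r + t ∧ p + q ≤ K ^ s ∧ r + t ≤ K ^ s ∧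
      (0 < s → 1 ≤ r) ∧ z 0 * (r * z s + t) = p * z s + q := by
  induction s with
  | zero => exact ⟨1, 0, 0, 1, by simp⟩
  | succ s ih =>
    obtain ⟨p, q, r, t, hp, hq, hr, ht, h1, h2, h3, -, h4⟩ := ih fun k hk => ha k (by omega)
    obtain ⟨a1, a2⟩ := ha s (by omega)
    refine ⟨p * a s + q, p, r * a s + t, r, by positivity, hp, by positivity, hr, ?_, ?_, ?_, ?_, ?_⟩
    · nlinarith
    · rw [pow_succ]; nlinarith
    · rw [pow_succ]; nlinarith
    · intro _; nlinarith
    · have h5 := (hz0 (s + 1)).ne'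
      rw [hz s] at h4
      push_cast
      field_simp at h4
      linear_combination h4

theorem conjPair_of_completeQuot (hx : Irrational x) (hw : 0 < w) (k : ℕ) {y : ℝ}
    (h : ConjPair w (completeQuot x k) y) : ConjPair w x (galConj x) := by
  induction k generalizing y with
  | zero =>
    change ConjPair w x y at h
    rwa [h.galConj_eq hw hx]
  | succ k ih =>
    have hirr := irrational_completeQuot hx (k + 1)
    have h1 := (h.inv hirr.ne_zero (h.irrational_right hw hirr).ne_zero).add_int (partialQuot x k)
    rw [completeQuot_succ, inv_inv, add_sub_cancel] at h1
    exact ih h1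

/-- The discriminant of a quadratic irrational is bounded in terms of the period of its continued
fraction expansion. -/
theorem exists_conjPair_le (hx : IsRealQuadratic x) :
    0 < periodLength x ∧ 3 ≤ periodBound x ∧ ∃ w : ℝ, 0 < w ∧ ConjPair w x (galConj x) ∧
      w ^ 2 ≤ (periodBound x : ℝ) ^ (2 * periodLength x + 2) := by
  have hirr := hx.irrational
  obtain ⟨w₀, hw₀, hpair₀⟩ := hx.exists_conjPair
  obtain ⟨hs0, hex⟩ : 0 < periodLength x ∧ ∃ N, PeriodicFrom x N (periodLength x) :=
    Nat.sInf_mem (exists_periodicFrom hirr hw₀ hpair₀)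
  have hper : PeriodicFrom x (preperiodLength x) (periodLength x) := Nat.sInf_mem hex
  set s := periodLength x with hs
  set m := preperiodLength x with hm
  -- From one period past the preperiod on, every index is positive, as `one_le_partialQuot_succ`
  -- requires.
  have hper' : PeriodicFrom x (m + s) s := fun k hk => hper k (by omega)
  have hB : ∀ i < s, 1 ≤ partialQuot x (m + s + i) ∧
      partialQuot x (m + s + i) + 1 ≤ (periodBound x : ℤ) - 1 := by
    intro i hi
    obtain ⟨j, hj⟩ : ∃ j, m + s + i = j + 1 := ⟨m + s + i - 1, by omega⟩
    refine ⟨hj ▸ one_le_partialQuot_succ hirr j, ?_⟩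
    have h1 : partialQuot x (m + s + i) = partialQuot x (m + i) := by
      rw [add_right_comm]; exact hper _ (Nat.le_add_right _ _)
    have h2 : (partialQuot x (m + i)).toNat ≤ (Finset.range s).sup
        (fun i => (partialQuot x (m + i)).toNat) :=
      Finset.le_sup (f := fun i => (partialQuot x (m + i)).toNat) (Finset.mem_range.2 hi)
    have h3 := Int.self_le_toNat (partialQuot x (m + i))
    have h4 : periodBound x = 2 + (Finset.range s).sup
        (fun i => (partialQuot x (m + i)).toNat) := rfl
    omega
  have hB3 : 3 ≤ periodBound x := by
    have := hB 0 hs0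
    omega
  refine ⟨hs0, hB3, ?_⟩
  obtain ⟨p, q, r, t, hp, hq, hr, ht, -, h2, h3, h4, h5⟩ := exists_bounded_matrix
    (fun k => completeQuot x (m + s + k)) (fun k => partialQuot x (m + s + k))
    ((periodBound x : ℤ) - 1)
    (fun k => by
      obtain ⟨j, hj⟩ : ∃ j, m + s + k = j + 1 := ⟨m + s + k - 1, by omega⟩
      rw [hj]
      exact one_pos.trans (one_lt_completeQuot_succ hirr j))
    (fun k => by
      rw [← add_assoc, completeQuot_succ, inv_inv, add_sub_cancel]) s hB
  simp only [add_zero] at h5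
  rw [completeQuot_eq_of_periodicFrom hirr hper'] at h5
  have hzirr := irrational_completeQuot hirr (m + s)
  generalize hz : completeQuot x (m + s) = z at h5 hzirr
  have hr1 : (1 : ℝ) ≤ r := by exact_mod_cast h4 hs0
  have hr0 : (r : ℝ) ≠ 0 := by positivity
  -- `z` is fixed by the matrix, hence a root of `r Z ^ 2 + (t - p) Z - q`; `y` is the other root.
  set y : ℝ := (p - t) / r - z with hy
  have e1 : (r : ℝ) * (z + y) = ((p - t : ℤ) : ℝ) := by
    rw [hy]; push_cast; field_simp; ring
  have e2 : (r : ℝ) * (z * y) = ((-q : ℤ) : ℝ) := by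
    have : (r : ℝ) * (z * y) = z * ((p - t : ℤ) : ℝ) - r * z * z := by rw [← e1]; ring
    rw [this]; push_cast; linear_combination -h5
  have hne : z - y ≠ 0 := by
    intro h0
    have h6 : z = y := sub_eq_zero.1 h0
    rw [← h6] at e1
    apply hzirr
    refine ⟨(p - t) / (2 * r), ?_⟩
    push_cast at e1 ⊢
    rw [div_eq_iff (by positivity), ← e1]
    ring
  have hwpos : 0 < |(r : ℝ) * (z - y)| := abs_pos.2 (mul_ne_zero hr0 hne)
  refine ⟨|(r : ℝ) * (z - y)|, hwpos, ?_, ?_⟩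
  · rcases abs_cases ((r : ℝ) * (z - y)) with ⟨h, -⟩ | ⟨h, -⟩
    · exact conjPair_of_completeQuot hirr hwpos (m + s) (y := y)
        (by rw [hz]; exact ⟨r, p - t, -q, h.symm, e1, e2⟩)
    · exact conjPair_of_completeQuot hirr hwpos (m + s) (y := y)
        (by rw [hz]; exact ConjPair.symm ⟨r, p - t, -q, by rw [h]; ring, by rw [← e1]; ring,
          by rw [← e2]; ring⟩)
  · have e3 : |(r : ℝ) * (z - y)| ^ 2 = (((p - t) ^ 2 + 4 * r * q : ℤ) : ℝ) := by
      rw [sq_abs]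
      have : ((r : ℝ) * (z - y)) ^ 2 = (r * (z + y)) ^ 2 - 4 * r * (r * (z * y)) := by ring
      rw [this, e1, e2]; push_cast; ring
    rw [e3]
    have hK : ((periodBound x : ℤ) - 1) ^ s ≤ (periodBound x : ℤ) ^ s :=
      pow_le_pow_left₀ (by omega) (by omega) s
    generalize ((periodBound x : ℤ) - 1) ^ s = k at h2 h3 hK
    have h6 : (p - t) ^ 2 + 4 * r * q ≤ 5 * (periodBound x : ℤ) ^ s * (periodBound x : ℤ) ^ s := by
      generalize (periodBound x : ℤ) ^ s = L at hK
      have h7 : r * q ≤ L * L := mul_le_mul (by linarith) (by linarith) hq (by linarith)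
      have h8 : (p - t) ^ 2 ≤ L * L := by
        rw [← sq]
        exact sq_le_sq' (by linarith) (by linarith)
      linarith
    have h9 : 5 * (periodBound x : ℤ) ^ s * (periodBound x : ℤ) ^ s ≤
        (periodBound x : ℤ) ^ (2 * s + 2) := by
      have e : (periodBound x : ℤ) ^ (2 * s + 2) =
        (periodBound x : ℤ) ^ 2 * ((periodBound x : ℤ) ^ s * (periodBound x : ℤ) ^ s) := by ring
      rw [e, mul_assoc]
      have : (5 : ℤ) ≤ (periodBound x : ℤ) ^ 2 := by
        have : (3 : ℤ) ≤ periodBound x := by exact_mod_cast hB3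
        nlinarith
      gcongr
    exact_mod_cast h6.trans h9

end CompleteQuotients

/-! ### Comparison with `psi` -/

/-- The choice of `n` gives `16 * 16 * 36 * 144 * w ^ 2 ≤ B ^ ((n - 1) s)`. The cube of the left
side exceeds `10 ^ 7 * w ^ 6`, and `3 (n - 1) s` is below the exponent in `psi`. -/
theorem psi_mul_le {α w : ℝ} (hs : 0 < periodLength α) (hB : 3 ≤ periodBound α) (hw : 1 ≤ w)
    (hwB : w ^ 2 ≤ (periodBound α : ℝ) ^ (2 * periodLength α + 2)) :
    0 < psi α ∧ psi α * (10 ^ 7 * w ^ 5) ≤ 1 := by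
  unfold psi
  generalize periodLength α = s at *
  generalize periodBound α = B at *
  have hB' : (3 : ℝ) ≤ B := by exact_mod_cast hB
  have hB1 : (1 : ℝ) ≤ B := by linarith
  -- Without nonemptiness, `sInf` in `minExp` would take its default value `0`.
  have hex : {n | 0 < n ∧ 16 * 16 * 36 * 144 * B ^ (2 * s + 8) < 2 ^ ((n - 1) * s)}.Nonempty := by
    refine ⟨16 * 16 * 36 * 144 * B ^ (2 * s + 8) + 1, Nat.succ_pos _, ?_⟩
    rw [Nat.add_sub_cancel]
    exact Nat.lt_two_pow_self.trans_le (Nat.pow_le_pow_right two_pos (Nat.le_mul_of_pos_right _ hs))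
  obtain ⟨hn0, hn⟩ := Nat.sInf_mem hex
  change 16 * 16 * 36 * 144 * B ^ (2 * s + 8) < 2 ^ ((minExp s B - 1) * s) at hn
  change 0 < minExp s B at hn0
  generalize minExp s B = n at *
  have hn' : (16 * 16 * 36 * 144 : ℝ) * (B : ℝ) ^ (2 * s + 8) ≤ (2 : ℝ) ^ ((n - 1) * s) := by
    exact_mod_cast hn.le
  have hpos : (0 : ℝ) < 72 * 72 * (B : ℝ) ^ (s * (6 * n + 6) + 4) := by positivity
  refine ⟨by positivity, ?_⟩
  rw [div_mul_eq_mul_div, one_mul, div_le_one hpos]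
  have h1 : w ^ 2 ≤ (B : ℝ) ^ (2 * s + 8) :=
    hwB.trans (pow_le_pow_right₀ hB1 (by omega))
  have h2 : (16 * 16 * 36 * 144 : ℝ) * w ^ 2 ≤ (B : ℝ) ^ ((n - 1) * s) := by
    refine le_trans ?_ (hn'.trans (pow_le_pow_left₀ two_pos.le (by linarith) _))
    gcongr
  have h3 : ((16 * 16 * 36 * 144 : ℝ) * w ^ 2) ^ 3 ≤ (B : ℝ) ^ (s * (6 * n + 6) + 4) := by
    refine (pow_le_pow_left₀ (by positivity) h2 3).trans ?_
    rw [← pow_mul]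
    apply pow_le_pow_right₀ hB1
    obtain ⟨k, rfl⟩ : ∃ k, n = k + 1 := ⟨n - 1, by omega⟩
    rw [Nat.add_sub_cancel]
    nlinarith
  have h4 : w ^ 5 ≤ w ^ 6 := pow_le_pow_right₀ hw (by norm_num)
  have h5 : 0 ≤ w ^ 6 := by positivity
  calc 10 ^ 7 * w ^ 5 ≤ 10 ^ 7 * w ^ 6 := by gcongr
    _ ≤ ((16 * 16 * 36 * 144 : ℝ) * w ^ 2) ^ 3 := by
      have : ((16 * 16 * 36 * 144 : ℝ) * w ^ 2) ^ 3 = (16 * 16 * 36 * 144 : ℝ) ^ 3 * w ^ 6 := by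
        ring
      rw [this]
      gcongr
      norm_num
    _ ≤ 72 * 72 * (B : ℝ) ^ (s * (6 * n + 6) + 4) := by linarith [h3]

end QuadLagrange

end

theorem theorem1 (α : ℝ) (hα : QuadLagrange.IsRealQuadratic α) :
    0 < QuadLagrange.psi α ∧
      Set.Icc (0 : ℝ) (QuadLagrange.psi α) ⊆ QuadLagrange.Sp α := by
  obtain ⟨hs, hB, w, hw, hpair, hwB⟩ := QuadLagrange.exists_conjPair_le hα
  obtain ⟨hψ, hψw⟩ := QuadLagrange.psi_mul_le hs hB (hpair.one_le hw) hwB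
  exact ⟨hψ, fun c hc => QuadLagrange.mem_Sp_of_orbitSystem
    (QuadLagrange.orbitSystem_Theta hα.irrational hw hpair) hc.1 hc.2 hψ hψw⟩
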